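/- All models are models of first-order Peano Arithmetic $\mathsf{PA}$ in the language $\{0,1,+,\cdot,<\}$; "definable" means definable with parameters. Let $\mathcal M\models\mathsf{PA}$ have domain $M$ and let $X\subseteq M$. * $X$ is *inductive* if $(\mathcal M,X)$ satisfies the induction scheme for all formulas of the language of $\mathsf{PA}$ with an additional unary predicate interpreted as $X$. * $X$ is a *class* of $\mathcal M$ if $\{x\in X: x<a\}$ is definable in $\mathcal M$ for every $a\in M$. * $X$ is *neutral* if $\operatorname{dcl}^{\mathcal M}(a)=\operatorname{dcl}^{(\mathcal M,X)}(a)$ for every $a\in M$, where $\operatorname{dcl}(a)$ is the set of elements definable from the parameter $a$. * $\mathcal M$ is *neutrally expandable* if it has an undefinable neutral class. * $X$ is *generic* if for every set $D$ of $0$-$1$ sequences coded in $\mathcal M$ that is definable in $\mathcal M$ and dense (every coded $0$-$1$ sequence has an extension in $D$), some initial segment of the characteristic function of $X$ belongs to $D$. * $\mathcal M$ is *prime* if it embeds elementarily into every model of its complete theory. **Proposition.** Let $\mathcal M\models\mathsf{PA}$ be prime and let $\mathcal N$ be a cofinal elementary extension of $\mathcal M$ (every element of $N$ is below some element of $M$).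 Then $\mathcal N$ is neutrally expandable. More precisely, $\mathcal M$ has a generic subset that is undefinable and inductive; and for every undefinable inductive $X\subseteq M$ there is a unique $Y\subseteq N$ with $(\mathcal M,X)\prec(\mathcal N,Y)$, and this $Y$ is an undefinable, inductive, neutral class of $\mathcal N$. If $X$ is generic in $\mathcal M$, then $Y$ is generic in $\mathcal N$. -/

import Mathlib

open FirstOrder FirstOrder.Language

namespace PeanoArith

universe u

/-! ### The language of arithmetic and Peano Arithmetic -/

/-- Function symbols `0, 1, +, ·` of arithmetic. -/
inductive ArithFunc : ℕ → Type
  | zero : ArithFunc 0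
  | one : ArithFunc 0
  | add : ArithFunc 2
  | mul : ArithFunc 2

/-- Relation symbol `<` of arithmetic. -/
inductive ArithRel : ℕ → Type
  | lt : ArithRel 2

/-- The language `{0, 1, +, ·, <}` of Peano Arithmetic. -/
def LPA : FirstOrder.Language.{0, 0} := ⟨ArithFunc, ArithRel⟩

section Terms

variable {α : Type*}

/-- The term `0`. -/
def zeroT : LPA.Term α := Constants.term (L := LPA) ArithFunc.zero

/-- The term `1`. -/
def oneT : LPA.Term α := Constants.term (L := LPA) ArithFunc.one

/-- The term `s + t`. -/
def addT (s t : LPA.Term α) : LPA.Term α := Functions.apply₂ (L := LPA) ArithFunc.add s t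

/-- The term `s · t`. -/
def mulT (s t : LPA.Term α) : LPA.Term α := Functions.apply₂ (L := LPA) ArithFunc.mul s t

/-- The atomic formula `s < t`. -/
def ltF {n : ℕ} (s t : LPA.Term (α ⊕ Fin n)) : LPA.BoundedFormula α n :=
  Relations.boundedFormula₂ (L := LPA) ArithRel.lt s t

end Terms

/-- The finitely many axioms of Peano Arithmetic other than induction: the axioms for the
successor function `x ↦ x + 1`, the recursion equations for `+` and `·`, and the definition
of `<`. -/
def basicAxioms : LPA.Theory :=
  { -- `x + 1 ≠ 0`
    ∀' ∼(addT (&0) oneT =' (zeroT : LPA.Term (Empty ⊕ Fin 1))),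
    -- `x + 1 = y + 1 → x = y`
    ∀' ∀' ((addT (&0) oneT =' (addT (&1) oneT : LPA.Term (Empty ⊕ Fin 2))) ⟹ (&0 =' &1)),
    -- `x + 0 = x`
    ∀' (addT (&0) zeroT =' (&0 : LPA.Term (Empty ⊕ Fin 1))),
    -- `x + (y + 1) = (x + y) + 1`
    ∀' ∀' (addT (&0) (addT (&1) oneT) =' (addT (addT (&0) (&1)) oneT :
      LPA.Term (Empty ⊕ Fin 2))),
    -- `x · 0 = 0`
    ∀' (mulT (&0) zeroT =' (zeroT : LPA.Term (Empty ⊕ Fin 1))),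
    -- `x · (y + 1) = x · y + x`
    ∀' ∀' (mulT (&0) (addT (&1) oneT) =' (addT (mulT (&0) (&1)) (&0) :
      LPA.Term (Empty ⊕ Fin 2))),
    -- `x < y ↔ ∃ z, (x + z) + 1 = y`
    ∀' ∀' ((ltF (&0) (&1) : LPA.BoundedFormula Empty 2).iff
      (∃' (addT (addT (&0) (&2)) oneT =' (&1 : LPA.Term (Empty ⊕ Fin 3))))) }

/-- The induction axiom for a formula `φ(p₁, …, pₙ, x)` of a language `L` that extends the
language of arithmetic by `η`: the universal closure of
`φ(p, 0) ∧ ∀ x, (φ(p, x) → φ(p, x + 1)) → ∀ x, φ(p, x)`. -/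
noncomputable def inductionAxiom {L : FirstOrder.Language.{0, 0}} (η : LPA →ᴸ L) {n : ℕ}
    (φ : L.Formula (Fin n ⊕ Unit)) : L.Sentence :=
  let atZero : L.Formula (Fin n) :=
    φ.subst (Sum.elim Term.var fun _ => η.onTerm zeroT)
  let atSucc : L.Formula (Fin n ⊕ Unit) :=
    φ.subst (Sum.elim (fun i => Term.var (Sum.inl i))
      fun u => η.onTerm (addT (Term.var (Sum.inr u)) oneT))
  let ind : L.Formula (Fin n) :=
    (atZero ⊓ Formula.iAlls Unit (φ.imp atSucc)).imp (Formula.iAlls Unit φ)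
  Formula.iAlls (Fin n) (ind.relabel (Sum.inr : Fin n → Empty ⊕ Fin n))

/-- Peano Arithmetic in a language `L` extending that of arithmetic by `η`: the basic axioms
together with induction for all formulas of `L`. -/
def PAStar {L : FirstOrder.Language.{0, 0}} (η : LPA →ᴸ L) : L.Theory :=
  η.onTheory basicAxioms ∪ {σ | ∃ (n : ℕ) (φ : L.Formula (Fin n ⊕ Unit)), σ = inductionAxiom η φ}

/-- Peano Arithmetic. -/
def PA : LPA.Theory := PAStar (LHom.id LPA)

/-! ### Prime models and cofinal extensions -/

/-- `M` is a prime model (of its complete theory): it embeds elementarily into every model of its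
complete theory. (By the downward Löwenheim–Skolem theorem it is enough to test this on the models
in one universe.) -/
def IsPrimeModel (M : Type u) [LPA.Structure M] : Prop :=
  ∀ (K : Type u) [LPA.Structure K] [K ⊨ LPA.completeTheory M], Nonempty (M ↪ₑ[LPA] K)

section Ops

variable {M : Type*} [LPA.Structure M]

/-- The order of a structure for the language of arithmetic. -/
def lt (a b : M) : Prop := Structure.RelMap (L := LPA) ArithRel.lt ![a, b]

/-- The constant `1` of a structure for the language of arithmetic. -/
def one (M : Type*) [LPA.Structure M] : M := Structure.funMap (L := LPA) ArithFunc.one ![]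

/-- Addition in a structure for the language of arithmetic. -/
def add (a b : M) : M := Structure.funMap (L := LPA) ArithFunc.add ![a, b]

/-- Multiplication in a structure for the language of arithmetic. -/
def mul (a b : M) : M := Structure.funMap (L := LPA) ArithFunc.mul ![a, b]

end Ops

/-- The elementary embedding `f : M → N` makes `N` a cofinal extension of `M`. -/
def IsCofinalExt {M N : Type*} [LPA.Structure M] [LPA.Structure N] (f : M ↪ₑ[LPA] N) : Prop :=
  ∀ b : N, ∃ a : M, lt b (f a)

/-! ### Expansions by a subset -/

/-- A single unary relation symbol. -/
inductive PredRel : ℕ → Type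
  | pred : PredRel 1

/-- The language with a single unary relation symbol. -/
def LPred : FirstOrder.Language.{0, 0} := ⟨fun _ => Empty, PredRel⟩

/-- The language of arithmetic with an additional unary relation symbol. -/
abbrev LPAX : FirstOrder.Language.{0, 0} := LPA.sum LPred

/-- The domain of the expansion `(M, X)` of the structure `M` by a subset `X`. -/
def Expansion {M : Type*} (_X : Set M) : Type _ := M

section Expansion

variable {M : Type*}

instance instStructureExpansion [h : LPA.Structure M] (X : Set M) :
    LPA.Structure (Expansion X) := h

instance instPredStructureExpansion (X : Set M) : LPred.Structure (Expansion X) where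
  funMap f := f.elim
  RelMap := fun
    | .pred => fun v => v 0 ∈ X

variable [LPA.Structure M]

/-- `X` is definable in `M`, with parameters. -/
def IsDefinable (X : Set M) : Prop := (Set.univ : Set M).Definable₁ LPA X

/-- `X` is inductive: `(M, X)` satisfies induction for all formulas of its language. -/
def IsInductive (X : Set M) : Prop :=
  Expansion X ⊨ PAStar (LHom.sumInl : LPA →ᴸ LPAX)

/-- `X` is a class of `M`: all its bounded initial parts are definable in `M`. -/
def IsClass (X : Set M) : Prop := ∀ a : M, IsDefinable {x | x ∈ X ∧ lt x a}

/-- The definable closure of the element `a` in a structure. -/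
def dcl (L : FirstOrder.Language.{0, 0}) {K : Type*} [L.Structure K] (a : K) : Set K :=
  {b | ({a} : Set K).Definable₁ L {b}}

/-- `X` is neutral: for each `a` the definable closures of `a` in `M` and in `(M, X)` agree. -/
def IsNeutral (X : Set M) : Prop :=
  ∀ a b : M, b ∈ dcl LPA (K := M) a ↔ b ∈ dcl LPAX (K := Expansion X) a

/-- `M` is neutrally expandable: it has an undefinable neutral class. -/
def NeutrallyExpandable (M : Type*) [LPA.Structure M] : Prop :=
  ∃ X : Set M, ¬ IsDefinable X ∧ IsNeutral X ∧ IsClass X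

/-- `(M, X) ≺ (N, Y)` along the elementary embedding `f : M → N`. -/
def IsElementaryExt {N : Type*} [LPA.Structure N] (f : M ↪ₑ[LPA] N) (X : Set M) (Y : Set N) :
    Prop :=
  ∃ g : Expansion X ↪ₑ[LPAX] Expansion Y, ∀ x : M, g x = f x

/-! ### Generic subsets

Conditions are the `0`-`1` sequences coded in `M`. They are coded by triples `p = (a, b, l)`: `l` is
the length, and the entry at `i < l` is `1` iff `1 + (i + 1) · b` divides `a` (as in Gödel's `β`
function; in a model of `PA` each bounded definable `0`-`1` sequence has such a code). -/

/-- The entry at `i` of the sequence coded by `p` is `1`. -/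
def entry (p : Fin 3 → M) (i : M) : Prop :=
  ∃ k : M, p 0 = mul k (add (one M) (mul (add i (one M)) (p 1)))

/-- The sequence coded by `p` extends the one coded by `q`. -/
def Extends (p q : Fin 3 → M) : Prop :=
  ¬ lt (p 2) (q 2) ∧ ∀ i : M, lt i (q 2) → (entry p i ↔ entry q i)

/-- A set of conditions is dense: each condition has an extension in it. -/
def IsDense (D : Set (Fin 3 → M)) : Prop := ∀ q, ∃ p ∈ D, Extends p q

/-- `X` is (Cohen) generic over `M`: each dense set of conditions definable in `M` with parameters
contains an initial segment of the characteristic function of `X`. -/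
def IsGeneric (X : Set M) : Prop :=
  ∀ D : Set (Fin 3 → M), (Set.univ : Set M).Definable LPA D → IsDense D →
    ∃ p ∈ D, ∀ i : M, lt i (p 2) → (entry p i ↔ i ∈ X)

end Expansion

end PeanoArith

/-! In a prime model of PA every element is definable without parameters. Indeed the least element
of a definable set is definable, so the definable elements form an elementary submodel
(`meetsDefinable_definable`), and an elementary embedding of `M` into it must fix every point
(`IsPrimeModel.definable_singleton`). Hence `M` is countable, and a chain of conditions that meets
every definable dense set yields a generic set (`exists_isGeneric`). Generic sets are undefinable by
a density argument. They are inductive by forcing: forcing is definable for each formula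
(`DefP.forces`), truth is forced by initial segments (`IsGeneric.realizeIn_iff`), and the least
number principle of `M` provides a least forceable counterexample to induction.

For inductive `X`, induction in `(M, X)` codes every bounded part of `X`, and `Y` is the set that
these codes describe in `N` (`extSet`). The heart of the proof is `exists_reflection`. By collection
in `(M, X)`, on arguments below a given `m` each formula about `(M, X)` becomes a formula about `M`:
quantifiers get bounds, and `X` is replaced by a code. Since the extension is cofinal, the same
formula with its parameters moved by `f` works for `(N, Y)`. This gives elementarity. It also gives
neutrality: a definition of `b` from `a` in `(N, Y)` turns into one in `N` with parameters from the
image of `M`, and these are definable. `Y` is unique because it is determined below each `f m` by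
the image of a code. Undefinability, induction and genericity pass to `Y` formula by formula, as
sentences of the expanded language.

`PDef` keeps formulas out of sight: it says that relations on two structures come from one formula
with corresponding parameters. -/

namespace PeanoArith

/-! ### Pairs of relations defined by a common formula -/

section PDef

variable {L : FirstOrder.Language.{0, 0}} {M N : Type*} [L.Structure M] [L.Structure N]
variable {A β γ : Type*} {ρ : A → M} {ρ' : A → N}

variable (L) in
/-- The functions `t` and `t'` are given in `M` and `N` by one `L`-term with parameters, which are
interpreted by `ρ` in `M` and by `ρ'` in `N`. -/
def PTm (ρ : A → M) (ρ' : A → N) (t : (β → M) → M) (t' : (β → N) → N) : Prop :=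
  ∃ τ : L.Term (A ⊕ β), (∀ w, t w = τ.realize (Sum.elim ρ w)) ∧
    ∀ w, t' w = τ.realize (Sum.elim ρ' w)

variable (L) in
/-- The relations `P` and `P'` are defined in `M` and `N` by one `L`-formula with parameters, which
are interpreted by `ρ` in `M` and by `ρ'` in `N`. -/
def PDef (ρ : A → M) (ρ' : A → N) (P : (β → M) → Prop) (P' : (β → N) → Prop) : Prop :=
  ∃ θ : L.Formula (A ⊕ β), (∀ w, P w ↔ θ.Realize (Sum.elim ρ w)) ∧
    ∀ w, P' w ↔ θ.Realize (Sum.elim ρ' w)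

theorem PTm.var (i : β) : PTm L ρ ρ' (fun w => w i) (fun w => w i) :=
  ⟨Term.var (Sum.inr i), fun _ => rfl, fun _ => rfl⟩

theorem PTm.param (a : A) :
    PTm L ρ ρ' (fun _ : β → M => ρ a) (fun _ : β → N => ρ' a) :=
  ⟨Term.var (Sum.inl a), fun _ => rfl, fun _ => rfl⟩

theorem PTm.comp {t : (β → M) → M} {t' : (β → N) → N} (h : PTm L ρ ρ' t t')
    {s : β → (γ → M) → M} {s' : β → (γ → N) → N} (hs : ∀ i, PTm L ρ ρ' (s i) (s' i)) :
    PTm L ρ ρ' (fun w => t fun i => s i w) (fun w => t' fun i => s' i w) := by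
  obtain ⟨τ, h1, h2⟩ := h
  choose σ k1 k2 using hs
  refine ⟨τ.subst (Sum.elim (fun a => Term.var (Sum.inl a)) σ), fun w => ?_, fun w => ?_⟩
  · beta_reduce; rw [h1, Term.realize_subst]; congr 1; funext a; cases a <;> simp [k1]
  · beta_reduce; rw [h2, Term.realize_subst]; congr 1; funext a; cases a <;> simp [k2]

theorem PDef.of_iff {P Q : (β → M) → Prop} {P' Q' : (β → N) → Prop} (h : PDef L ρ ρ' P P')
    (h1 : ∀ w, Q w ↔ P w) (h2 : ∀ w, Q' w ↔ P' w) : PDef L ρ ρ' Q Q' := by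
  obtain ⟨θ, a, b⟩ := h
  exact ⟨θ, fun w => (h1 w).trans (a w), fun w => (h2 w).trans (b w)⟩

theorem PDef.eq {t s : (β → M) → M} {t' s' : (β → N) → N} (h : PTm L ρ ρ' t t')
    (k : PTm L ρ ρ' s s') : PDef L ρ ρ' (fun w => t w = s w) (fun w => t' w = s' w) := by
  obtain ⟨τ, h1, h2⟩ := h
  obtain ⟨σ, k1, k2⟩ := k
  exact ⟨Term.equal τ σ, fun w => by beta_reduce; rw [Formula.realize_equal, h1, k1],
    fun w => by beta_reduce; rw [Formula.realize_equal, h2, k2]⟩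

theorem PDef.rel {n : ℕ} (R : L.Relations n) {t : Fin n → (β → M) → M}
    {t' : Fin n → (β → N) → N} (h : ∀ i, PTm L ρ ρ' (t i) (t' i)) :
    PDef L ρ ρ' (fun w => Structure.RelMap R fun i => t i w)
      (fun w => Structure.RelMap R fun i => t' i w) := by
  choose τ h1 h2 using h
  exact ⟨Relations.formula R τ, fun w => by simp [h1], fun w => by simp [h2]⟩

theorem PDef.comp {P : (β → M) → Prop} {P' : (β → N) → Prop} (h : PDef L ρ ρ' P P')
    {s : β → (γ → M) → M} {s' : β → (γ → N) → N} (hs : ∀ i, PTm L ρ ρ' (s i) (s' i)) :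
    PDef L ρ ρ' (fun w => P fun i => s i w) (fun w => P' fun i => s' i w) := by
  obtain ⟨θ, h1, h2⟩ := h
  choose σ k1 k2 using hs
  refine ⟨θ.subst (Sum.elim (fun a => Term.var (Sum.inl a)) σ), fun w => ?_, fun w => ?_⟩
  · beta_reduce; rw [h1]; refine Iff.trans ?_ BoundedFormula.realize_subst.symm
    apply iff_of_eq; unfold Formula.Realize; congr 1; funext a; cases a <;> simp [k1]
  · beta_reduce; rw [h2]; refine Iff.trans ?_ BoundedFormula.realize_subst.symm
    apply iff_of_eq; unfold Formula.Realize; congr 1; funext a; cases a <;> simp [k2]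

theorem PDef.reindex {P : (β → M) → Prop} {P' : (β → N) → Prop} (h : PDef L ρ ρ' P P')
    (e : β → γ) : PDef L ρ ρ' (fun w => P fun i => w (e i)) (fun w => P' fun i => w (e i)) :=
  h.comp fun i => PTm.var (e i)

theorem PTm.term (τ : L.Term β) : PTm L ρ ρ' (fun w => τ.realize w) (fun w => τ.realize w) :=
  ⟨τ.relabel Sum.inr, fun _ => by rw [Term.realize_relabel]; rfl,
    fun _ => by rw [Term.realize_relabel]; rfl⟩

theorem PDef.formula (θ : L.Formula β) {s : β → (γ → M) → M} {s' : β → (γ → N) → N}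
    (hs : ∀ i, PTm L ρ ρ' (s i) (s' i)) :
    PDef L ρ ρ' (fun w => θ.Realize fun i => s i w) (fun w => θ.Realize fun i => s' i w) := by
  have : PDef L ρ ρ' (fun w : β → M => θ.Realize w) (fun w : β → N => θ.Realize w) :=
    ⟨θ.relabel Sum.inr, fun _ => by rw [Formula.realize_relabel]; rfl,
      fun _ => by rw [Formula.realize_relabel]; rfl⟩
  exact this.comp hs

theorem PDef.boundedFormula {n : ℕ} (φ : L.BoundedFormula β n) {s : β → (γ → M) → M}
    {s' : β → (γ → N) → N} {u : Fin n → (γ → M) → M} {u' : Fin n → (γ → N) → N}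
    (hs : ∀ i, PTm L ρ ρ' (s i) (s' i)) (hu : ∀ i, PTm L ρ ρ' (u i) (u' i)) :
    PDef L ρ ρ' (fun w => φ.Realize (fun i => s i w) fun i => u i w)
      (fun w => φ.Realize (fun i => s' i w) fun i => u' i w) := by
  have := PDef.formula φ.toFormula (s := Sum.elim s u) (s' := Sum.elim s' u')
    (Sum.rec hs hu : ∀ i, PTm L ρ ρ' (Sum.elim s u i) (Sum.elim s' u' i))
  refine this.of_iff (fun w => ?_) fun w => ?_ <;>
  · rw [BoundedFormula.realize_toFormula]; rfl

theorem PDef.const (p : Prop) : PDef L ρ ρ' (fun _ : β → M => p) (fun _ : β → N => p) := by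
  by_cases h : p
  · exact ⟨⊤, fun _ => by simp [h], fun _ => by simp [h]⟩
  · exact ⟨⊥, fun _ => by simp [h], fun _ => by simp [h]⟩

section Connectives

variable {P Q : (β → M) → Prop} {P' Q' : (β → N) → Prop}

theorem PDef.imp (h : PDef L ρ ρ' P P') (k : PDef L ρ ρ' Q Q') :
    PDef L ρ ρ' (fun w => P w → Q w) (fun w => P' w → Q' w) := by
  obtain ⟨θ, h1, h2⟩ := h
  obtain ⟨σ, k1, k2⟩ := k
  exact ⟨θ.imp σ, fun w => by beta_reduce; rw [Formula.realize_imp, h1, k1],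
    fun w => by beta_reduce; rw [Formula.realize_imp, h2, k2]⟩

theorem PDef.not (h : PDef L ρ ρ' P P') : PDef L ρ ρ' (fun w => ¬ P w) (fun w => ¬ P' w) :=
  h.imp (PDef.const False)

theorem PDef.and (h : PDef L ρ ρ' P P') (k : PDef L ρ ρ' Q Q') :
    PDef L ρ ρ' (fun w => P w ∧ Q w) (fun w => P' w ∧ Q' w) :=
  (h.imp k.not).not.of_iff (fun _ => by tauto) fun _ => by tauto

theorem PDef.or (h : PDef L ρ ρ' P P') (k : PDef L ρ ρ' Q Q') :
    PDef L ρ ρ' (fun w => P w ∨ Q w) (fun w => P' w ∨ Q' w) :=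
  (h.not.imp k).of_iff (fun _ => by tauto) fun _ => by tauto

theorem PDef.iff (h : PDef L ρ ρ' P P') (k : PDef L ρ ρ' Q Q') :
    PDef L ρ ρ' (fun w => P w ↔ Q w) (fun w => P' w ↔ Q' w) :=
  ((h.imp k).and (k.imp h)).of_iff (fun _ => by tauto) fun _ => by tauto

end Connectives

theorem PDef.forallTuple [Finite γ] {P : (β → M) → (γ → M) → Prop}
    {P' : (β → N) → (γ → N) → Prop}
    (h : PDef L ρ ρ' (fun w : β ⊕ γ → M => P (fun i => w (Sum.inl i)) fun i => w (Sum.inr i))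
      (fun w => P' (fun i => w (Sum.inl i)) fun i => w (Sum.inr i))) :
    PDef L ρ ρ' (fun w => ∀ u, P w u) (fun w => ∀ u, P' w u) := by
  obtain ⟨θ, h1, h2⟩ := h
  refine ⟨Formula.iAlls γ (θ.relabel (Equiv.sumAssoc A β γ).symm), fun w => ?_, fun w => ?_⟩
  · rw [Formula.realize_iAlls]
    refine forall_congr' fun u => ?_
    rw [Formula.realize_relabel]
    refine Iff.trans (h1 (Sum.elim w u)) (iff_of_eq ?_)
    congr 1; funext a; rcases a with a | a | a <;> rfl
  · rw [Formula.realize_iAlls]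
    refine forall_congr' fun u => ?_
    rw [Formula.realize_relabel]
    refine Iff.trans (h2 (Sum.elim w u)) (iff_of_eq ?_)
    congr 1; funext a; rcases a with a | a | a <;> rfl

theorem PDef.existsTuple [Finite γ] {P : (β → M) → (γ → M) → Prop}
    {P' : (β → N) → (γ → N) → Prop}
    (h : PDef L ρ ρ' (fun w : β ⊕ γ → M => P (fun i => w (Sum.inl i)) fun i => w (Sum.inr i))
      (fun w => P' (fun i => w (Sum.inl i)) fun i => w (Sum.inr i))) :
    PDef L ρ ρ' (fun w => ∃ u, P w u) (fun w => ∃ u, P' w u) :=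
  (PDef.forallTuple (P := fun w u => ¬ P w u) (P' := fun w u => ¬ P' w u) h.not).not.of_iff
    (fun _ => by simp) fun _ => by simp

theorem PDef.all {P : (β → M) → M → Prop} {P' : (β → N) → N → Prop}
    (h : PDef L ρ ρ' (fun w : Option β → M => P (fun i => w (some i)) (w none))
      (fun w => P' (fun i => w (some i)) (w none))) :
    PDef L ρ ρ' (fun w => ∀ x, P w x) (fun w => ∀ x, P' w x) := by
  have := PDef.forallTuple (γ := Unit) (P := fun w u => P w (u ())) (P' := fun w u => P' w (u ()))
    (h.reindex (fun i : Option β => i.elim (Sum.inr ()) Sum.inl))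
  refine this.of_iff (fun w => ?_) fun w => ?_
  · exact ⟨fun h u => h _, fun h x => h fun _ => x⟩
  · exact ⟨fun h u => h _, fun h x => h fun _ => x⟩

theorem PDef.ex {P : (β → M) → M → Prop} {P' : (β → N) → N → Prop}
    (h : PDef L ρ ρ' (fun w : Option β → M => P (fun i => w (some i)) (w none))
      (fun w => P' (fun i => w (some i)) (w none))) :
    PDef L ρ ρ' (fun w => ∃ x, P w x) (fun w => ∃ x, P' w x) :=
  (PDef.all (P := fun w x => ¬ P w x) (P' := fun w x => ¬ P' w x) h.not).not.of_iff
    (fun _ => by simp) fun _ => by simp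

theorem PDef.allFin [Finite γ] {P : γ → (β → M) → Prop} {P' : γ → (β → N) → Prop}
    (h : ∀ c, PDef L ρ ρ' (P c) (P' c)) :
    PDef L ρ ρ' (fun w => ∀ c, P c w) (fun w => ∀ c, P' c w) := by
  choose θ h1 h2 using h
  exact ⟨Formula.iInf θ, fun w => by simp [h1], fun w => by simp [h2]⟩

theorem PDef.expand {L' : FirstOrder.Language.{0, 0}} [L'.Structure M] [L'.Structure N]
    {P : (β → M) → Prop} {P' : (β → N) → Prop} (h : PDef L ρ ρ' P P')
    (η : L →ᴸ L') [η.IsExpansionOn M] [η.IsExpansionOn N] : PDef L' ρ ρ' P P' := by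
  obtain ⟨θ, h1, h2⟩ := h
  exact ⟨η.onFormula θ, fun w => by rw [LHom.realize_onFormula, h1],
    fun w => by rw [LHom.realize_onFormula, h2]⟩

/-- The purpose of working with pairs: elementarity of `f` applies to the hidden formula, which is
never displayed. -/
theorem PDef.map_iff {f : M ↪ₑ[L] N} {P : (β → M) → Prop} {P' : (β → N) → Prop}
    (h : PDef L ρ (fun a => f (ρ a)) P P') (w : β → M) : P w ↔ P' fun i => f (w i) := by
  obtain ⟨θ, h1, h2⟩ := h
  rw [h1, h2, ← f.map_formula θ]
  apply iff_of_eq; congr 1; funext a; cases a <;> rfl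

/-- The quantifiers are absorbed into the formula, so the transferred statement covers all tuples of
`N`, not only images of tuples of `M`. -/
theorem PDef.forall_map_iff [Finite β] {f : M ↪ₑ[L] N} {P : (β → M) → Prop} {P' : (β → N) → Prop}
    (h : PDef L ρ (fun a => f (ρ a)) P P') : (∀ w, P w) ↔ ∀ w, P' w := by
  have := PDef.forallTuple (β := Empty) (P := fun _ => P) (P' := fun _ => P') (h.reindex Sum.inr)
  exact this.map_iff Empty.elim

end PDef

/-! ### Definability with parameters -/

section Definability

variable {L : FirstOrder.Language.{0, 0}} {M : Type*} [L.Structure M] {β : Type*}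

theorem definable_iff_PDef {S : Set (β → M)} {A : Set M} :
    A.Definable L S ↔ PDef L (Subtype.val : A → M) (Subtype.val : A → M) (· ∈ S) (· ∈ S) := by
  rw [Set.definable_iff_exists_formula_sum]
  constructor
  · rintro ⟨θ, rfl⟩; exact ⟨θ, fun _ => Iff.rfl, fun _ => Iff.rfl⟩
  · rintro ⟨θ, h, _⟩; exact ⟨θ, Set.ext h⟩

/-- The relation `P` is definable with parameters. -/
abbrev DefP (L : FirstOrder.Language.{0, 0}) {M : Type*} [L.Structure M] {β : Type*}
    (P : (β → M) → Prop) : Prop := PDef L (id : M → M) (id : M → M) P P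

theorem DefP.of_iff {P Q : (β → M) → Prop} (h : DefP L P) (k : ∀ w, Q w ↔ P w) : DefP L Q :=
  PDef.of_iff h k k

theorem definable_univ_iff_DefP {S : Set (β → M)} :
    (Set.univ : Set M).Definable L S ↔ DefP L (· ∈ S) := by
  rw [definable_iff_PDef]
  constructor
  · rintro ⟨θ, h, -⟩
    have : ∀ w, w ∈ S ↔ (θ.relabel (Sum.map Subtype.val id) : L.Formula (M ⊕ β)).Realize
        (Sum.elim id w) := fun w => by
      refine (h w).trans ?_
      rw [Formula.realize_relabel]
      apply iff_of_eq; congr 1; funext a; cases a <;> rfl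
    exact ⟨_, this, this⟩
  · rintro ⟨θ, h, -⟩
    have : ∀ w, w ∈ S ↔ (θ.relabel (Sum.map (fun a => ⟨a, Set.mem_univ a⟩) id) :
        L.Formula ((Set.univ : Set M) ⊕ β)).Realize (Sum.elim Subtype.val w) := fun w => by
      refine (h w).trans ?_
      rw [Formula.realize_relabel]
      apply iff_of_eq; congr 1; funext a; cases a <;> rfl
    exact ⟨_, this, this⟩

theorem PDef.left {A N : Type*} [L.Structure N] {ρ : A → M} {ρ' : A → N} {P : (β → M) → Prop}
    {P' : (β → N) → Prop} (h : PDef L ρ ρ' P P') : DefP L P := by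
  obtain ⟨θ, h, -⟩ := h
  have : ∀ w, P w ↔ (θ.relabel (Sum.map ρ id)).Realize (Sum.elim id w) := fun w => by
    rw [h, Formula.realize_relabel]
    apply iff_of_eq; congr 1; funext a; cases a <;> rfl
  exact ⟨_, this, this⟩

theorem PTm.elem (a : M) :
    PTm L (id : M → M) (id : M → M) (fun _ : β → M => a) (fun _ => a) := PTm.param a

/-- Only finitely many parameters are needed. -/
theorem DefP.exists_formula_fin {P : (β → M) → Prop} (hP : DefP L P) :
    ∃ (n : ℕ) (φ : L.Formula (Fin n ⊕ β)) (p : Fin n → M),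
      ∀ w, P w ↔ φ.Realize (Sum.elim p w) := by
  classical
  obtain ⟨θ, hθ, -⟩ := hP
  let V : Finset M := θ.freeVarFinset.toLeft
  let e := V.equivFin
  let g : θ.freeVarFinset → Fin V.card ⊕ β := fun x => Sum.casesOn x.1
    (fun a (h : Sum.inl a ∈ θ.freeVarFinset) => Sum.inl (e ⟨a, by simpa [V] using h⟩))
    (fun b _ => Sum.inr b) x.2
  refine ⟨V.card, θ.restrictFreeVar g, fun i => e.symm i, fun w => ?_⟩
  refine (hθ w).trans (BoundedFormula.realize_restrictFreeVar _ ?_).symm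
  rintro ⟨a | b, h⟩
  · simp [g]
  · simp [g]

/-- Definability over parameters each of which is definable over `B`. -/
theorem definable_of_definable_params {A B : Set M} (h : ∀ a ∈ A, B.Definable₁ L {a})
    {S : Set (β → M)} (hS : A.Definable L S) : B.Definable L S := by
  classical
  obtain ⟨A₀, hA, hS⟩ := Set.definable_iff_finitely_definable.1 hS
  obtain ⟨θ, hθ⟩ := Set.definable_iff_exists_formula_sum.1 hS
  -- The parameters become a quantified tuple `u`, pinned down by the definitions of its entries
  -- over `B`.
  have hB : PDef L (Subtype.val : B → M) (Subtype.val : B → M)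
      (fun w : β → M => ∃ u : A₀ → M, (∀ a, u a = a) ∧ θ.Realize (Sum.elim u w))
      (fun w : β → M => ∃ u : A₀ → M, (∀ a, u a = a) ∧ θ.Realize (Sum.elim u w)) := by
    refine PDef.existsTuple (PDef.and (PDef.allFin fun a => ?_) ?_)
    · have := definable_iff_PDef.1 (h a (hA a.2))
      exact this.reindex fun _ => Sum.inr a
    · refine ⟨θ.relabel (Sum.elim (fun a => Sum.inr (Sum.inr a)) (fun b => Sum.inr (Sum.inl b))),
        ?_, ?_⟩ <;>
      · intro w
        rw [Formula.realize_relabel]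
        beta_reduce
        apply iff_of_eq; congr 1; funext a; cases a <;> rfl
  refine definable_iff_PDef.2 (hB.of_iff ?_ ?_) <;>
  · intro w
    rw [hθ]
    constructor
    · intro hw
      exact ⟨fun a => a, fun _ => rfl, hw⟩
    · rintro ⟨u, hu, hw⟩
      have : u = fun a : A₀ => (a : M) := funext hu
      subst this
      exact hw

end Definability

/-! ### Models of Peano Arithmetic as ordered semirings -/

section Operations

variable {M : Type*} [LPA.Structure M]

instance instZeroStructure : Zero M := ⟨Structure.funMap (L := LPA) ArithFunc.zero ![]⟩

instance instOneStructure : One M := ⟨one M⟩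

instance instAddStructure : Add M := ⟨add⟩

instance instMulStructure : Mul M := ⟨mul⟩

variable {α : Type*} (v : α → M)

theorem realize_zeroT : (zeroT : LPA.Term α).realize v = 0 :=
  congrArg (Structure.funMap (L := LPA) ArithFunc.zero) (Subsingleton.elim _ _)

theorem realize_oneT : (oneT : LPA.Term α).realize v = 1 :=
  congrArg (Structure.funMap (L := LPA) ArithFunc.one) (Subsingleton.elim _ _)

theorem realize_addT (s t : LPA.Term α) : (addT s t).realize v = s.realize v + t.realize v := by
  exact Term.realize_functions_apply₂

theorem realize_mulT (s t : LPA.Term α) : (mulT s t).realize v = s.realize v * t.realize v := by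
  exact Term.realize_functions_apply₂

theorem realize_ltF {n : ℕ} (s t : LPA.Term (α ⊕ Fin n)) (xs : Fin n → M) :
    (ltF s t).Realize v xs ↔ lt (s.realize (Sum.elim v xs)) (t.realize (Sum.elim v xs)) := by
  exact BoundedFormula.realize_rel₂

variable {N A β : Type*} [LPA.Structure N] {ρ : A → M} {ρ' : A → N} {t s : (β → M) → M}
  {t' s' : (β → N) → N}

theorem PTm.zero : PTm LPA ρ ρ' (fun _ : β → M => 0) (fun _ : β → N => 0) :=
  ⟨zeroT, fun _ => (realize_zeroT _).symm, fun _ => (realize_zeroT _).symm⟩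

theorem PTm.one : PTm LPA ρ ρ' (fun _ : β → M => 1) (fun _ : β → N => 1) :=
  ⟨oneT, fun _ => (realize_oneT _).symm, fun _ => (realize_oneT _).symm⟩

theorem PTm.add (h : PTm LPA ρ ρ' t t') (k : PTm LPA ρ ρ' s s') :
    PTm LPA ρ ρ' (fun w => t w + s w) (fun w => t' w + s' w) := by
  obtain ⟨τ, h1, h2⟩ := h
  obtain ⟨σ, k1, k2⟩ := k
  exact ⟨addT τ σ, fun w => by beta_reduce; rw [realize_addT, h1, k1],
    fun w => by beta_reduce; rw [realize_addT, h2, k2]⟩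

theorem PTm.mul (h : PTm LPA ρ ρ' t t') (k : PTm LPA ρ ρ' s s') :
    PTm LPA ρ ρ' (fun w => t w * s w) (fun w => t' w * s' w) := by
  obtain ⟨τ, h1, h2⟩ := h
  obtain ⟨σ, k1, k2⟩ := k
  exact ⟨mulT τ σ, fun w => by beta_reduce; rw [realize_mulT, h1, k1],
    fun w => by beta_reduce; rw [realize_mulT, h2, k2]⟩

theorem PDef.lt (h : PTm LPA ρ ρ' t t') (k : PTm LPA ρ ρ' s s') :
    PDef LPA ρ ρ' (fun w => lt (t w) (s w)) (fun w => PeanoArith.lt (t' w) (s' w)) := by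
  have := PDef.rel (L := LPA) ArithRel.lt (t := ![t, s]) (t' := ![t', s']) (ρ := ρ) (ρ' := ρ')
    (Fin.forall_fin_two.2 ⟨h, k⟩)
  refine this.of_iff (fun w => iff_of_eq ?_) fun w => iff_of_eq ?_ <;>
  · unfold PeanoArith.lt
    congr 1
    funext i
    fin_cases i <;> rfl

end Operations

/-! ### The induction scheme in semantic form -/

section Induction

variable {L : FirstOrder.Language.{0, 0}} {η : LPA →ᴸ L} {K : Type*} [LPA.Structure K]
  [L.Structure K] [η.IsExpansionOn K]

theorem realize_inductionAxiom {n : ℕ} (φ : L.Formula (Fin n ⊕ Unit)) :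
    K ⊨ inductionAxiom η φ ↔ ∀ p : Fin n → K, φ.Realize (Sum.elim p fun _ => 0) →
      (∀ x, φ.Realize (Sum.elim p fun _ => x) → φ.Realize (Sum.elim p fun _ => x + 1)) →
      ∀ x, φ.Realize (Sum.elim p fun _ => x) := by
  have h0 : ∀ p : Fin n → K,
      Formula.Realize (φ.subst (Sum.elim Term.var fun _ => η.onTerm zeroT)) p ↔
        φ.Realize (Sum.elim p fun _ => 0) := fun p => by
    refine BoundedFormula.realize_subst.trans (iff_of_eq ?_)
    unfold Formula.Realize
    congr 1; funext a
    cases a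
    · rfl
    · exact (LHom.realize_onTerm η zeroT p).trans (realize_zeroT p)
  have h1 : ∀ (p : Fin n → K) (u : Unit → K),
      Formula.Realize (φ.subst (Sum.elim (fun i => Term.var (Sum.inl i))
        fun u => η.onTerm (addT (Term.var (Sum.inr u)) oneT))) (Sum.elim p u) ↔
        φ.Realize (Sum.elim p fun _ => u () + 1) := fun p u => by
    refine BoundedFormula.realize_subst.trans (iff_of_eq ?_)
    unfold Formula.Realize
    congr 1; funext a
    cases a
    · rfl
    · refine (LHom.realize_onTerm η _ _).trans ?_
      rw [realize_addT, realize_oneT]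
      rfl
  have hu : ∀ {P : (Unit → K) → Prop}, (∀ u, P u) ↔ ∀ x, P fun _ => x :=
    ⟨fun h x => h _, fun h u => h (u ())⟩
  unfold inductionAxiom Sentence.Realize
  simp only [Formula.realize_iAlls, Formula.realize_relabel, Formula.realize_imp,
    Formula.realize_inf, and_imp]
  refine forall_congr' fun p => ?_
  have e : (fun a => Sum.elim (default : Empty → K) p a) ∘ (Sum.inr : Fin n → Empty ⊕ Fin n) = p :=
    rfl
  rw [e, h0]
  refine imp_congr_right fun _ => ?_
  rw [hu, hu]
  refine imp_congr ?_ Iff.rfl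
  refine forall_congr' fun x => imp_congr_right fun _ => ?_
  exact h1 p _

/-- Induction for relations that are definable with parameters. -/
theorem induction_of_DefP (h : K ⊨ PAStar η) {P : K → Prop}
    (hP : DefP L fun w : Unit → K => P (w ())) (h0 : P 0) (hs : ∀ x, P x → P (x + 1)) (x : K) :
    P x := by
  obtain ⟨n, φ, p, hφ⟩ := hP.exists_formula_fin
  have hi : K ⊨ inductionAxiom η φ :=
    Theory.realize_sentence_of_mem (PAStar η) (Or.inr ⟨_, _, rfl⟩)
  have key : ∀ x, P x ↔ φ.Realize (Sum.elim p fun _ => x) := fun x => hφ fun _ => x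
  rw [realize_inductionAxiom] at hi
  have := hi p
  simp only [← key] at this
  exact this h0 hs x

/-- The axioms of Peano Arithmetic in terms of the operations of the structure. -/
theorem models_PAStar_iff : K ⊨ PAStar η ↔ K ⊨ basicAxioms ∧
    ∀ P : K → Prop, (DefP L fun w : Unit → K => P (w ())) → P 0 → (∀ x, P x → P (x + 1)) →
      ∀ x, P x := by
  constructor
  · intro h
    refine ⟨?_, fun P hP => induction_of_DefP h hP⟩
    rw [← LHom.onTheory_model η]
    exact h.mono Set.subset_union_left
  · rintro ⟨h, hi⟩
    rw [Theory.model_iff]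
    rintro σ (hσ | ⟨n, φ, rfl⟩)
    · rw [← LHom.onTheory_model η] at h
      exact Theory.realize_sentence_of_mem _ hσ
    · rw [realize_inductionAxiom]
      intro p
      have hd : ∀ w : Unit → K, φ.Realize (Sum.elim p fun _ => w ()) ↔
          (φ.relabel (Sum.map p id)).Realize (Sum.elim id w) := fun w => by
        rw [Formula.realize_relabel]
        apply iff_of_eq; congr 1; funext a; cases a <;> rfl
      exact hi (fun x => φ.Realize (Sum.elim p fun _ => x)) ⟨_, hd, hd⟩

end Induction

/-- The structure `M` is a model of Peano Arithmetic. -/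
class ModelsPA (M : Type*) [LPA.Structure M] : Prop where
  models : M ⊨ PA

section Algebra

variable {M : Type*} [LPA.Structure M]

theorem models_basicAxioms_iff : M ⊨ basicAxioms ↔
    (∀ x : M, x + 1 ≠ 0) ∧ (∀ x y : M, x + 1 = y + 1 → x = y) ∧ (∀ x : M, x + 0 = x) ∧
    (∀ x y : M, x + (y + 1) = x + y + 1) ∧ (∀ x : M, x * 0 = 0) ∧
    (∀ x y : M, x * (y + 1) = x * y + x) ∧ ∀ x y : M, lt x y ↔ ∃ z, x + z + 1 = y := by
  simp only [basicAxioms, Theory.model_iff, Set.mem_insert_iff, Set.mem_singleton_iff,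
    forall_eq_or_imp, forall_eq]
  simp only [Sentence.Realize, Formula.Realize, BoundedFormula.realize_all,
    BoundedFormula.realize_not, BoundedFormula.realize_imp, BoundedFormula.realize_iff,
    BoundedFormula.realize_ex, BoundedFormula.realize_bdEqual, realize_addT, realize_mulT,
    realize_zeroT, realize_oneT, realize_ltF]
  rfl

variable [h : ModelsPA M]

theorem basic_axioms :
    (∀ x : M, x + 1 ≠ 0) ∧ (∀ x y : M, x + 1 = y + 1 → x = y) ∧ (∀ x : M, x + 0 = x) ∧
    (∀ x y : M, x + (y + 1) = x + y + 1) ∧ (∀ x : M, x * 0 = 0) ∧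
    (∀ x y : M, x * (y + 1) = x * y + x) ∧ ∀ x y : M, lt x y ↔ ∃ z, x + z + 1 = y :=
  models_basicAxioms_iff.1 (models_PAStar_iff.1 h.models).1

theorem arith_induction {P : M → Prop} (hP : DefP LPA fun w : Unit → M => P (w ())) (h0 : P 0)
    (hs : ∀ x, P x → P (x + 1)) (x : M) : P x :=
  induction_of_DefP h.models hP h0 hs x

end Algebra

/-! ### Semiring and order laws derived by induction -/

section Algebra

variable {M : Type*} [LPA.Structure M] [ModelsPA M]

theorem pa_add_zero (x : M) : x + 0 = x := basic_axioms.2.2.1 x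

theorem pa_add_succ (x y : M) : x + (y + 1) = x + y + 1 := basic_axioms.2.2.2.1 x y

theorem pa_mul_zero (x : M) : x * 0 = 0 := basic_axioms.2.2.2.2.1 x

theorem pa_mul_succ (x y : M) : x * (y + 1) = x * y + x := basic_axioms.2.2.2.2.2.1 x y

theorem pa_lt_iff (x y : M) : lt x y ↔ ∃ z, x + z + 1 = y := basic_axioms.2.2.2.2.2.2 x y

theorem pa_zero_add (x : M) : 0 + x = x := by
  refine arith_induction (P := fun x => 0 + x = x) ?_ ?_ (fun x h => ?_) x
  · apply_rules [PDef.eq, PTm.var, PTm.add, PTm.zero]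
  · exact pa_add_zero 0
  · rw [pa_add_succ, h]

theorem pa_succ_add (x y : M) : x + 1 + y = x + y + 1 := by
  refine arith_induction (P := fun y => x + 1 + y = x + y + 1) ?_ ?_ (fun y h => ?_) y
  · apply_rules [PDef.eq, PTm.var, PTm.add, PTm.zero, PTm.one, PTm.elem]
  · rw [pa_add_zero, pa_add_zero]
  · rw [pa_add_succ, h, pa_add_succ]

theorem pa_add_comm (x y : M) : x + y = y + x := by
  refine arith_induction (P := fun y => x + y = y + x) ?_ ?_ (fun y h => ?_) y
  · apply_rules [PDef.eq, PTm.var, PTm.add, PTm.zero, PTm.one, PTm.elem]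
  · rw [pa_add_zero, pa_zero_add]
  · rw [pa_add_succ, h, pa_succ_add]

theorem pa_add_assoc (x y z : M) : x + y + z = x + (y + z) := by
  refine arith_induction (P := fun z => x + y + z = x + (y + z)) ?_ ?_ (fun z h => ?_) z
  · apply_rules [PDef.eq, PTm.var, PTm.add, PTm.zero, PTm.one, PTm.elem]
  · rw [pa_add_zero, pa_add_zero]
  · rw [pa_add_succ, h, pa_add_succ, pa_add_succ]

theorem pa_zero_mul (x : M) : 0 * x = 0 := by
  refine arith_induction (P := fun x => 0 * x = 0) ?_ ?_ (fun x h => ?_) x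
  · apply_rules [PDef.eq, PTm.var, PTm.mul, PTm.zero]
  · exact pa_mul_zero 0
  · rw [pa_mul_succ, h, pa_add_zero]

theorem pa_succ_mul (x y : M) : (x + 1) * y = x * y + y := by
  refine arith_induction (P := fun y => (x + 1) * y = x * y + y) ?_ ?_ (fun y h => ?_) y
  · apply_rules [PDef.eq, PTm.var, PTm.add, PTm.mul, PTm.zero, PTm.one, PTm.elem]
  · rw [pa_mul_zero, pa_mul_zero, pa_add_zero]
  · rw [pa_mul_succ, h, pa_mul_succ, pa_add_succ, pa_add_succ,
      pa_add_assoc (x * y) y x, pa_add_comm y x, pa_add_assoc (x * y) x y]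

theorem pa_mul_comm (x y : M) : x * y = y * x := by
  refine arith_induction (P := fun y => x * y = y * x) ?_ ?_ (fun y h => ?_) y
  · apply_rules [PDef.eq, PTm.var, PTm.mul, PTm.zero, PTm.one, PTm.elem]
  · rw [pa_mul_zero, pa_zero_mul]
  · rw [pa_mul_succ, h, pa_succ_mul]

theorem pa_mul_add (x y z : M) : x * (y + z) = x * y + x * z := by
  refine arith_induction (P := fun z => x * (y + z) = x * y + x * z) ?_ ?_ (fun z h => ?_) z
  · apply_rules [PDef.eq, PTm.var, PTm.add, PTm.mul, PTm.zero, PTm.one, PTm.elem]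
  · rw [pa_mul_zero, pa_add_zero, pa_add_zero]
  · rw [pa_add_succ, pa_mul_succ, h, pa_mul_succ, pa_add_assoc]

theorem pa_mul_assoc (x y z : M) : x * y * z = x * (y * z) := by
  refine arith_induction (P := fun z => x * y * z = x * (y * z)) ?_ ?_ (fun z h => ?_) z
  · apply_rules [PDef.eq, PTm.var, PTm.add, PTm.mul, PTm.zero, PTm.one, PTm.elem]
  · rw [pa_mul_zero, pa_mul_zero, pa_mul_zero]
  · rw [pa_mul_succ, h, pa_mul_succ, pa_mul_add]

theorem pa_mul_one (x : M) : x * 1 = x := by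
  rw [← pa_zero_add (1 : M), pa_mul_succ, pa_mul_zero, pa_zero_add]

theorem pa_add_right_cancel (x y z : M) : x + z = y + z → x = y := by
  refine arith_induction (P := fun z => x + z = y + z → x = y) ?_ ?_ (fun z h => ?_) z
  · apply_rules [PDef.imp, PDef.eq, PTm.var, PTm.add, PTm.mul, PTm.zero, PTm.one, PTm.elem]
  · rw [pa_add_zero, pa_add_zero]; exact id
  · rw [pa_add_succ, pa_add_succ]
    exact fun k => h (basic_axioms.2.1 _ _ k)

theorem eq_zero_or_succ (x : M) : x = 0 ∨ ∃ y, x = y + 1 := by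
  refine arith_induction (P := fun x => x = 0 ∨ ∃ y, x = y + 1) ?_ ?_
    (fun x _ => Or.inr ⟨x, rfl⟩) x
  · apply_rules [PDef.or, PDef.ex, PDef.eq, PTm.var, PTm.add, PTm.zero, PTm.one]
  · exact Or.inl rfl

/-- This is totality of the order; when `y` grows by one, a zero difference `z` changes sides and a
successor drops by one. -/
theorem exists_add (x y : M) : (∃ z, x + z = y) ∨ ∃ z, y + z = x := by
  refine arith_induction (P := fun y => (∃ z, x + z = y) ∨ ∃ z, y + z = x) ?_
    (Or.inr ⟨x, pa_zero_add x⟩) (fun y h => ?_) y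
  · apply_rules [PDef.or, PDef.ex, PDef.imp, PDef.eq, PTm.var, PTm.add, PTm.mul, PTm.zero, PTm.one,
      PTm.elem]
  · rcases h with ⟨z, rfl⟩ | ⟨z, rfl⟩
    · exact Or.inl ⟨z + 1, pa_add_succ _ _⟩
    · rcases eq_zero_or_succ z with rfl | ⟨z, rfl⟩
      · exact Or.inl ⟨1, by rw [pa_add_zero]⟩
      · exact Or.inr ⟨z, by rw [pa_succ_add, pa_add_succ]⟩

instance instCommSemiringModel : CommSemiring M where
  add_assoc := pa_add_assoc
  zero_add := pa_zero_add
  add_zero := pa_add_zero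
  add_comm := pa_add_comm
  left_distrib := pa_mul_add
  right_distrib x y z := by
    rw [pa_mul_comm (x + y) z, pa_mul_add, pa_mul_comm z x, pa_mul_comm z y]
  zero_mul := pa_zero_mul
  mul_zero := pa_mul_zero
  mul_assoc := pa_mul_assoc
  one_mul x := by rw [pa_mul_comm, pa_mul_one]
  mul_one := pa_mul_one
  mul_comm := pa_mul_comm
  nsmul := nsmulRec
  natCast := Nat.unaryCast

instance instCancelModel : IsRightCancelAdd M where
  add_right_cancel x y z h := pa_add_right_cancel y z x h

theorem add_one_ne_zero' (x : M) : x + 1 ≠ 0 := basic_axioms.1 x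

theorem eq_zero_of_add_eq_zero {x y : M} (h : x + y = 0) : y = 0 := by
  rcases eq_zero_or_succ y with rfl | ⟨z, rfl⟩
  · rfl
  · rw [← add_assoc] at h
    exact absurd h (add_one_ne_zero' _)

/-- `<` is the relation of the structure by definition, so that definability facts about `lt` apply
to it unchanged; `≤` is the existence of a difference. -/
noncomputable instance instLinearOrderModel : LinearOrder M where
  le x y := ∃ z, x + z = y
  lt := lt
  le_refl x := ⟨0, add_zero x⟩
  le_trans := by
    rintro x _ _ ⟨u, rfl⟩ ⟨v, rfl⟩
    exact ⟨u + v, (add_assoc _ _ _).symm⟩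
  lt_iff_le_not_ge x y := by
    rw [pa_lt_iff]
    constructor
    · rintro ⟨z, rfl⟩
      refine ⟨⟨z + 1, (add_assoc _ _ _).symm⟩, ?_⟩
      rintro ⟨u, hu⟩
      have : (z + u) + 1 = 0 := by
        apply add_right_cancel (b := x)
        rw [zero_add]
        refine Eq.trans ?_ hu
        ring
      exact add_one_ne_zero' _ this
    · rintro ⟨⟨z, rfl⟩, h⟩
      rcases eq_zero_or_succ z with rfl | ⟨u, rfl⟩
      · exact absurd ⟨0, by rw [add_zero, add_zero]⟩ h
      · exact ⟨u, add_assoc _ _ _⟩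
  le_antisymm := by
    rintro x _ ⟨u, rfl⟩ ⟨v, hv⟩
    have : u + v = 0 := by
      apply add_right_cancel (b := x)
      rw [zero_add]
      refine Eq.trans ?_ hv
      ring
    rw [add_comm] at this
    rw [eq_zero_of_add_eq_zero this, add_zero]
  le_total := exists_add
  toDecidableLE := Classical.decRel _

instance instOrderedModel : IsStrictOrderedRing M := by
  have hadd : ∀ a b c : M, a ≤ b → a + c ≤ b + c := by
    rintro a _ c ⟨u, rfl⟩
    exact ⟨u, by ring⟩
  have : IsOrderedAddMonoid M :=
    { add_le_add_left := fun a b h c => hadd a b c h }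
  have hcancel : ∀ a b c : M, a + b ≤ a + c → b ≤ c := by
    rintro a b c ⟨u, hu⟩
    refine ⟨u, add_right_cancel (b := a) ?_⟩
    rw [add_comm c, ← hu]
    ring
  have : IsOrderedCancelAddMonoid M :=
    { le_of_add_le_add_left := hcancel }
  have h01 : (0 : M) < 1 := (pa_lt_iff 0 1).2 ⟨0, by rw [add_zero, zero_add]⟩
  have hpos : ∀ a b c : M, a < b → 0 < c → a * c < b * c := by
    intro a b c hab hc
    obtain ⟨u, rfl⟩ := (pa_lt_iff a b).1 hab
    obtain ⟨v, rfl⟩ := (pa_lt_iff 0 c).1 hc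
    -- With `b = a + u + 1` and `c = v + 1` the products differ by `u * v + u + v + 1`; the summand
    -- `a * 0` vanishes.
    refine (pa_lt_iff _ _).2 ⟨a * 0 + u * v + u + v, ?_⟩
    ring
  exact
    { zero_le_one := h01.le
      exists_pair_ne := ⟨0, 1, h01.ne⟩
      mul_lt_mul_of_pos_left := fun _ ha _ _ h => by
        simpa only [mul_comm] using hpos _ _ _ h ha
      mul_lt_mul_of_pos_right := fun _ ha _ _ h => hpos _ _ _ h ha }

instance instCanonicallyOrderedModel : CanonicallyOrderedAdd M where
  exists_add_of_le := fun ⟨c, hc⟩ => ⟨c, hc.symm⟩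
  le_self_add _ b := ⟨b, rfl⟩
  le_add_self _ b := ⟨b, add_comm _ _⟩

theorem lt_add_one_iff' {a b : M} : a < b + 1 ↔ a ≤ b := by
  constructor
  · intro h
    obtain ⟨z, hz⟩ := (pa_lt_iff a (b + 1)).1 h
    exact ⟨z, add_right_cancel hz⟩
  · intro h
    exact h.trans_lt (lt_add_one b)

theorem add_one_le_iff' {a b : M} : a + 1 ≤ b ↔ a < b := by
  rw [← not_lt, lt_add_one_iff', not_le]

end Algebra

section OrderDefinability

variable {M N A β : Type*} [LPA.Structure M] [LPA.Structure N] [ModelsPA M] [ModelsPA N]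
  {ρ : A → M} {ρ' : A → N} {t s : (β → M) → M} {t' s' : (β → N) → N}

theorem PDef.lt' (h : PTm LPA ρ ρ' t t') (k : PTm LPA ρ ρ' s s') :
    PDef LPA ρ ρ' (fun w => t w < s w) (fun w => t' w < s' w) := PDef.lt h k

end OrderDefinability

section EntryDefinability

variable {M N A β : Type*} [LPA.Structure M] [LPA.Structure N]
  {ρ : A → M} {ρ' : A → N} {t : (β → M) → M} {t' : (β → N) → N}
  {p : Fin 3 → (β → M) → M} {p' : Fin 3 → (β → N) → N}

theorem PDef.entry (hp : ∀ i, PTm LPA ρ ρ' (p i) (p' i)) (h : PTm LPA ρ ρ' t t') :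
    PDef LPA ρ ρ' (fun w => entry (fun i => p i w) (t w))
      (fun w => PeanoArith.entry (fun i => p' i w) (t' w)) := by
  refine PDef.ex (PDef.eq ?_ (PTm.mul (PTm.var _) (PTm.add PTm.one (PTm.mul
    (PTm.add ?_ PTm.one) ?_))))
  · exact (hp 0).comp fun i => PTm.var (some i)
  · exact h.comp fun i => PTm.var (some i)
  · exact (hp 1).comp fun i => PTm.var (some i)

end EntryDefinability

/-! ### The least number principle and collection -/

section Principles

variable {L : FirstOrder.Language.{0, 0}} {η : LPA →ᴸ L} {K : Type*} [LPA.Structure K]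
  [L.Structure K] [η.IsExpansionOn K] [ModelsPA K]

/-- The least number principle for relations that are definable with parameters. -/
theorem exists_least (h : K ⊨ PAStar η) {P : K → Prop}
    (hP : DefP L fun w : Unit → K => P (w ())) {a : K} (ha : P a) :
    ∃ b, P b ∧ ∀ c < b, ¬ P c := by
  by_contra! hne
  -- Strong induction, phrased as ordinary induction on a bound `x` below which `P` fails.
  have key : ∀ x : K, ∀ c, c < x → ¬ P c := by
    refine fun x => induction_of_DefP h (P := fun x => ∀ c, c < x → ¬ P c) ?_ ?_ ?_ x
    · exact PDef.all (PDef.imp ((PDef.lt' (PTm.var _) (PTm.var _)).expand η)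
        (PDef.not (hP.reindex fun _ => none)))
    · exact fun c hc => absurd hc not_lt_zero
    · intro x ih c hc hPc
      obtain ⟨d, hd, hPd⟩ := hne c hPc
      exact ih d (hd.trans_le (lt_add_one_iff'.1 hc)) hPd
  exact key (a + 1) a (lt_add_one a) ha

/-- Collection in one variable, for monotone relations. -/
theorem exists_bound_of_monotone (h : K ⊨ PAStar η) {Q : K → K → Prop}
    (hQ : DefP L fun w : Option Unit → K => Q (w (some ())) (w none))
    (hmono : ∀ x u u', u ≤ u' → Q x u → Q x u') (m : K) (hex : ∀ x, ∃ u, Q x u) :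
    ∃ u, ∀ x, x < m → Q x u := by
  refine induction_of_DefP h (P := fun m => ∃ u, ∀ x, x < m → Q x u) ?_ ?_ ?_ m
  · refine PDef.ex (PDef.all (PDef.imp ((PDef.lt' (PTm.var _) (PTm.var _)).expand η) ?_))
    exact hQ.reindex fun o => o.elim (some none) fun _ => none
  · exact ⟨0, fun x hx => absurd hx not_lt_zero⟩
  · rintro x ⟨u, hu⟩
    obtain ⟨v, hv⟩ := hex x
    refine ⟨max u v, fun y hy => ?_⟩
    rcases (lt_add_one_iff'.1 hy).lt_or_eq with h | rfl
    · exact hmono _ _ _ (le_max_left _ _) (hu y h)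
    · exact hmono _ _ _ (le_max_right _ _) hv

/-- Induction on the number of variables. For each value `a` of the first coordinate the remaining
ones have a bound; being a bound is monotone, so `exists_bound_of_monotone` finds one that serves
all `a < m`. -/
theorem collection_fin (h : K ⊨ PAStar η) (m : K) : ∀ {n : ℕ} {P : (Fin n → K) → K → Prop},
    (DefP L fun w : Option (Fin n) → K => P (fun i => w (some i)) (w none)) →
    ∃ u, ∀ x, (∀ i, x i < m) → (∃ y, P x y) → ∃ y, y < u ∧ P x y
  | 0, P, hP => by
    by_cases hy : ∃ y, P Fin.elim0 y
    · obtain ⟨y, hy⟩ := hy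
      refine ⟨y + 1, fun x _ _ => ⟨y, lt_add_one y, ?_⟩⟩
      rwa [Subsingleton.elim x Fin.elim0]
    · refine ⟨0, fun x _ hx => absurd ?_ hy⟩
      rwa [Subsingleton.elim Fin.elim0 x]
  | n + 1, P, hP => by
    have hP' : DefP L fun w : Option (Option Unit ⊕ Fin n) → K =>
        P (Fin.cons (w (some (Sum.inl (some ())))) fun i => w (some (Sum.inr i))) (w none) := by
      refine PDef.comp (s := fun o w => Option.elim o (w none) fun i =>
        (Fin.cons (w (some (Sum.inl (some ())))) fun i => w (some (Sum.inr i)) : Fin (n + 1) → K) i)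
        (s' := fun o w => Option.elim o (w none) fun i =>
        (Fin.cons (w (some (Sum.inl (some ())))) fun i => w (some (Sum.inr i)) : Fin (n + 1) → K) i)
        hP ?_
      rintro (_ | i)
      · exact PTm.var _
      · refine Fin.cases ?_ (fun i => ?_) i
        · exact PTm.var _
        · exact PTm.var _
    have hQ : DefP L fun w : Option Unit → K => ∀ x : Fin n → K, (∀ i, x i < m) →
        (∃ y, P (Fin.cons (w (some ())) x) y) →
          ∃ y, y < w none ∧ P (Fin.cons (w (some ())) x) y := by
      refine PDef.forallTuple (PDef.imp (PDef.allFin fun i => ?_) (PDef.imp (PDef.ex ?_)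
        (PDef.ex (PDef.and ?_ ?_))))
      · exact (PDef.lt' (PTm.var _) (PTm.elem m)).expand η
      · exact hP'.reindex fun o => o.elim none fun
          | Sum.inl a => some (Sum.inl a)
          | Sum.inr i => some (Sum.inr i)
      · exact (PDef.lt' (PTm.var _) (PTm.var _)).expand η
      · exact hP'.reindex fun o => o.elim none fun
          | Sum.inl a => some (Sum.inl a)
          | Sum.inr i => some (Sum.inr i)
    have hPa : ∀ a, DefP L fun w : Option (Fin n) → K =>
        P (Fin.cons a fun i => w (some i)) (w none) := fun a => by
      refine PDef.comp (s := fun o w => Option.elim o (w none) fun i =>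
        (Fin.cons a fun i => w (some i) : Fin (n + 1) → K) i)
        (s' := fun o w => Option.elim o (w none) fun i =>
        (Fin.cons a fun i => w (some i) : Fin (n + 1) → K) i) hP ?_
      rintro (_ | i)
      · exact PTm.var _
      · refine Fin.cases ?_ (fun i => ?_) i
        · exact PTm.elem a
        · exact PTm.var _
    obtain ⟨u, hu⟩ := exists_bound_of_monotone h (Q := fun a u => ∀ x : Fin n → K, (∀ i, x i < m) →
        (∃ y, P (Fin.cons a x) y) → ∃ y, y < u ∧ P (Fin.cons a x) y) hQ
      (fun a u u' huu' H x hx hy => (H x hx hy).imp fun y hy => ⟨hy.1.trans_le huu', hy.2⟩) m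
      fun a => collection_fin h m (P := fun x y => P (Fin.cons a x) y) (hPa a)
    refine ⟨u, fun x hx hy => ?_⟩
    have := hu (x 0) (hx 0) (Fin.tail x) (fun i => hx i.succ)
    rw [Fin.cons_self_tail] at this
    exact this hy

/-- Collection for relations that are definable with parameters. -/
theorem collection (h : K ⊨ PAStar η) (m : K) {β : Type*} [Finite β] {P : (β → K) → K → Prop}
    (hP : DefP L fun w : Option β → K => P (fun i => w (some i)) (w none)) :
    ∃ u, ∀ x, (∀ i, x i < m) → (∃ y, P x y) → ∃ y, y < u ∧ P x y := by
  obtain ⟨n, ⟨e⟩⟩ := Finite.exists_equiv_fin β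
  obtain ⟨u, hu⟩ := collection_fin h m (P := fun x y => P (fun i => x (e i)) y)
    (hP.reindex fun o => o.map e)
  refine ⟨u, fun x hx hy => ?_⟩
  have := hu (fun i => x (e.symm i)) (fun i => hx _)
  simp only [Equiv.symm_apply_apply] at this
  exact this hy

end Principles

/-! ### Codes of bounded sets -/

section Coding

variable {M : Type*} [LPA.Structure M] [ModelsPA M]

theorem entry_iff {p : Fin 3 → M} {i : M} : entry p i ↔ 1 + (i + 1) * p 1 ∣ p 0 := by
  refine exists_congr fun k => ?_
  rw [mul_comm]
  rfl

theorem entry_congr {p q : Fin 3 → M} (h0 : p 0 = q 0) (h1 : p 1 = q 1) (i : M) :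
    entry p i ↔ entry q i := by
  rw [entry_iff, entry_iff, h0, h1]

/-- In place of a subtraction the two cofactors are compared; if that of the sum is the smaller one,
then `x = 0`. -/
theorem dvd_of_dvd_add {d x y : M} (h : d ∣ x + y) (hy : d ∣ y) : d ∣ x := by
  obtain ⟨s, hs⟩ := h
  obtain ⟨t, rfl⟩ := hy
  rcases le_total t s with hts | hst
  · obtain ⟨w, rfl⟩ := exists_add_of_le hts
    refine ⟨w, add_right_cancel (b := d * t) ?_⟩
    rw [hs]; ring
  · have : x + d * t ≤ 0 + d * t := by
      rw [hs, zero_add]; exact mul_le_mul_right hst d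
    have hx : x = 0 := nonpos_iff_eq_zero.1 (le_of_add_le_add_right this)
    rw [hx]; exact dvd_zero d

/-- The modulus is prime to `b`: `x` plus a multiple of `x * b` is `x` times the modulus. -/
theorem dvd_of_dvd_mul_modulus {b x i : M} (h : 1 + (i + 1) * b ∣ x * b) :
    1 + (i + 1) * b ∣ x := by
  refine dvd_of_dvd_add (y := (i + 1) * (x * b)) ⟨x, ?_⟩ (h.mul_left _)
  ring

theorem dvd_of_dvd_mul_divisor {b e x i : M} (he : e ∣ b) (h : 1 + (i + 1) * b ∣ x * e) :
    1 + (i + 1) * b ∣ x := by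
  obtain ⟨u, rfl⟩ := he
  refine dvd_of_dvd_mul_modulus ?_
  rw [← mul_assoc x]
  exact h.mul_right u

/-- If `i ≠ k` are less than `l` and all nonzero numbers up to `l` divide `b`, then
`1 + (i + 1) b` and `1 + (k + 1) b` are coprime. -/
theorem dvd_of_dvd_mul_coprime {l b a i k : M} (hb : ∀ j, j < l → j + 1 ∣ b) (hi : i < l)
    (hk : k < l) (hik : i ≠ k) (h : 1 + (i + 1) * b ∣ a * (1 + (k + 1) * b)) :
    1 + (i + 1) * b ∣ a := by
  -- The two moduli differ by `(e + 1) * b`, where `e + 1` is the distance of the indices and hence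
  -- a divisor of `b`.
  have main : ∀ e : M, e < l → 1 + (i + 1) * b ∣ a * (e + 1) * b → 1 + (i + 1) * b ∣ a :=
    fun e he hd => dvd_of_dvd_mul_divisor (hb e he) (dvd_of_dvd_mul_modulus hd)
  rcases lt_or_gt_of_ne hik with hlt | hlt
  · obtain ⟨e, rfl⟩ := (pa_lt_iff i k).1 hlt
    refine main e ?_ ?_
    · refine lt_of_le_of_lt ?_ hk
      exact ⟨i + 1, by ring⟩
    · refine dvd_of_dvd_add (y := a * (1 + (i + 1) * b)) ?_ (dvd_mul_left _ _)
      convert h using 1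
      ring
  · obtain ⟨e, rfl⟩ := (pa_lt_iff k i).1 hlt
    refine main e ?_ ?_
    · refine lt_of_le_of_lt ?_ hi
      exact ⟨k + 1, by ring⟩
    · refine dvd_of_dvd_add ?_ h
      refine ⟨a, ?_⟩
      ring

/-- The induction builds a factorial of `l`. That `b` is nonzero makes the moduli in `exists_code`
greater than `1`. -/
theorem exists_common_multiple (l : M) : ∃ b : M, b ≠ 0 ∧ ∀ j, j < l → j + 1 ∣ b := by
  refine arith_induction (P := fun l => ∃ b : M, b ≠ 0 ∧ ∀ j, j < l → ∃ c, b = (j + 1) * c)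
    ?_ ?_ ?_ l
  · refine PDef.ex (PDef.and (PDef.not (PDef.eq ?_ ?_)) (PDef.all (PDef.imp (PDef.lt' ?_ ?_)
      (PDef.ex (PDef.eq ?_ ?_))))) <;> apply_rules [PTm.var, PTm.add, PTm.mul, PTm.zero, PTm.one]
  · exact ⟨1, one_ne_zero, fun j hj => absurd hj not_lt_zero⟩
  · rintro l ⟨b, hb, h⟩
    refine ⟨b * (l + 1), mul_ne_zero hb (add_one_ne_zero' l), fun j hj => ?_⟩
    rcases (lt_add_one_iff'.1 hj).lt_or_eq with h' | rfl
    · obtain ⟨c, rfl⟩ := h j h'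
      exact ⟨c * (l + 1), by ring⟩
    · exact ⟨b, by ring⟩

/-- Bounded parts of sets that are definable in a model of induction are coded. -/
theorem exists_code {L : FirstOrder.Language.{0, 0}} {η : LPA →ᴸ L} [L.Structure M]
    [η.IsExpansionOn M] (h : M ⊨ PAStar η) {S : M → Prop}
    (hS : DefP L fun w : Unit → M => S (w ())) (l : M) :
    ∃ p : Fin 3 → M, p 2 = l ∧ ∀ i, i < l → (entry p i ↔ S i) := by
  obtain ⟨b, hb0, hb⟩ := exists_common_multiple l
  -- `a` is the product of the moduli `1 + (i + 1) * b` over those `i < k` below `l` that satisfy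
  -- `S`, built by induction on `k`.
  have key : ∀ k : M, ∃ a : M, ∀ i, i < l → ((∃ c, a = (1 + (i + 1) * b) * c) ↔ i < k ∧ S i) := by
    refine fun k => induction_of_DefP h (P := fun k => ∃ a : M, ∀ i, i < l →
      ((∃ c, a = (1 + (i + 1) * b) * c) ↔ i < k ∧ S i)) ?_ ?_ ?_ k
    · refine PDef.ex (PDef.all (PDef.imp (PDef.expand (PDef.lt' ?_ ?_) η)
        (PDef.iff (PDef.expand (PDef.ex (PDef.eq ?_ ?_)) η)
          (PDef.and (PDef.expand (PDef.lt' ?_ ?_) η) (hS.reindex fun _ => none))))) <;>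
      apply_rules [PTm.var, PTm.add, PTm.mul, PTm.zero, PTm.one, PTm.elem]
    · refine ⟨1, fun i _ => ⟨?_, fun hi => absurd hi.1 not_lt_zero⟩⟩
      rintro ⟨c, hc⟩
      exfalso
      have hc0 : c ≠ 0 := by rintro rfl; rw [mul_zero] at hc; exact one_ne_zero hc
      have h1 : (1 : M) ≤ c := by
        rw [← zero_add (1 : M), add_one_le_iff']; exact pos_iff_ne_zero.2 hc0
      have h2 : 0 < (i + 1) * b := pos_iff_ne_zero.2 (mul_ne_zero (add_one_ne_zero' i) hb0)
      have h3 : (1 + (i + 1) * b) * 1 ≤ (1 + (i + 1) * b) * c := mul_le_mul_right h1 _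
      rw [← hc, mul_one] at h3
      exact absurd h3 (not_le.2 (lt_add_of_pos_right _ h2))
    · rintro k ⟨a, ha⟩
      by_cases hk : k < l ∧ S k
      · refine ⟨a * (1 + (k + 1) * b), fun i hi => ?_⟩
        rcases eq_or_ne i k with rfl | hik
        · exact ⟨fun _ => ⟨lt_add_one i, hk.2⟩, fun _ => ⟨a, mul_comm _ _⟩⟩
        · have hlt : i < k + 1 ↔ i < k := by rw [lt_add_one_iff', le_iff_lt_or_eq]; tauto
          rw [hlt, ← ha i hi]
          exact ⟨fun hd => dvd_of_dvd_mul_coprime hb hi hk.1 hik hd,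
            fun hd => Dvd.dvd.mul_right hd _⟩
      · refine ⟨a, fun i hi => (ha i hi).trans ?_⟩
        rw [lt_add_one_iff', le_iff_lt_or_eq]
        constructor
        · exact fun h => ⟨Or.inl h.1, h.2⟩
        · rintro ⟨h | rfl, hs⟩
          · exact ⟨h, hs⟩
          · exact absurd ⟨hi, hs⟩ hk
  obtain ⟨a, ha⟩ := key l
  refine ⟨![a, b, l], rfl, fun i hi => ?_⟩
  rw [entry_iff]
  exact (ha i hi).trans (and_iff_right hi)

end Coding

/-! ### Formulas of the language with a predicate -/

/-- Terms of the language with a predicate are terms of the language of arithmetic. -/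
def toLPA {α : Type*} : LPAX.Term α → LPA.Term α
  | Term.var a => Term.var a
  | Term.func (Sum.inl f) ts => Term.func f fun i => toLPA (ts i)
  | Term.func (Sum.inr f) _ => f.elim

section Expansion

variable {M : Type*} [LPA.Structure M]

theorem realize_toLPA {α : Type*} (X : Set M) (v : α → M) : ∀ t : LPAX.Term α,
    t.realize (M := Expansion X) v = (toLPA t).realize v
  | Term.var _ => rfl
  | Term.func (Sum.inl f) ts =>
    congrArg (Structure.funMap (L := LPA) (M := M) f) (funext fun i => realize_toLPA X v (ts i))
  | Term.func (Sum.inr f) _ => f.elim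

/-- Satisfaction in `(M, X)`, for assignments in `M`. -/
def RealizeIn (X : Set M) {α : Type*} {n : ℕ} (φ : LPAX.BoundedFormula α n) (v : α → M)
    (xs : Fin n → M) : Prop :=
  φ.Realize (M := Expansion X) v xs

section RealizeIn

variable {X : Set M} {α : Type*} {n : ℕ} {v : α → M} {xs : Fin n → M}

theorem realizeIn_equal {t s : LPAX.Term (α ⊕ Fin n)} :
    RealizeIn X (BoundedFormula.equal t s) v xs ↔
      (toLPA t).realize (Sum.elim v xs) = (toLPA s).realize (Sum.elim v xs) := by
  rw [← realize_toLPA X, ← realize_toLPA X]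
  rfl

theorem realizeIn_rel {l : ℕ} {R : LPA.Relations l} {ts : Fin l → LPAX.Term (α ⊕ Fin n)} :
    RealizeIn X (BoundedFormula.rel (L := LPAX) (Sum.inl R) ts) v xs ↔
      Structure.RelMap (L := LPA) R fun i => (toLPA (ts i)).realize (Sum.elim v xs) := by
  simp only [← realize_toLPA X]
  rfl

theorem realizeIn_pred {ts : Fin 1 → LPAX.Term (α ⊕ Fin n)} :
    RealizeIn X (BoundedFormula.rel (L := LPAX) (Sum.inr PredRel.pred) ts) v xs ↔
      (toLPA (ts 0)).realize (Sum.elim v xs) ∈ X := by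
  rw [← realize_toLPA X]
  rfl

theorem realizeIn_imp {φ ψ : LPAX.BoundedFormula α n} :
    RealizeIn X (φ.imp ψ) v xs ↔ (RealizeIn X φ v xs → RealizeIn X ψ v xs) := Iff.rfl

theorem realizeIn_all {φ : LPAX.BoundedFormula α (n + 1)} :
    RealizeIn X φ.all v xs ↔ ∀ a, RealizeIn X φ v (Fin.snoc xs a) := Iff.rfl

end RealizeIn

theorem DefP.realizeIn {X : Set M} {α β : Type*} {n : ℕ} (φ : LPAX.BoundedFormula α n)
    {s : α → (β → M) → M} {u : Fin n → (β → M) → M}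
    (hs : ∀ i, PTm LPAX (M := Expansion X) (N := Expansion X) id id (s i) (s i))
    (hu : ∀ i, PTm LPAX (M := Expansion X) (N := Expansion X) id id (u i) (u i)) :
    DefP LPAX (M := Expansion X) fun w => RealizeIn X φ (fun i => s i w) fun i => u i w :=
  PDef.boundedFormula φ hs hu

instance instModelsPAExpansion [h : ModelsPA M] (X : Set M) : ModelsPA (Expansion X) := h

theorem PDef.mem {N A β : Type*} [LPA.Structure N] {X : Set M} {Y : Set N} {ρ : A → Expansion X}
    {ρ' : A → Expansion Y} {t : (β → Expansion X) → Expansion X}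
    {t' : (β → Expansion Y) → Expansion Y} (h : PTm LPAX ρ ρ' t t') :
    PDef LPAX ρ ρ' (fun w => (t w : M) ∈ X) (fun w => (t' w : N) ∈ Y) :=
  PDef.rel (L := LPAX) (n := 1) (Sum.inr PredRel.pred) (t := fun _ => t) (t' := fun _ => t')
    fun _ => h

/-- Coding uses induction in the expanded language, and this is where inductiveness of `X` makes it
a class. -/
theorem IsInductive.exists_initial_code [ModelsPA M] {X : Set M} (hX : IsInductive X) (l : M) :
    ∃ p : Fin 3 → M, ∀ i, i < l → (entry p i ↔ i ∈ X) := by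
  obtain ⟨p, -, hp⟩ := exists_code (M := Expansion X) hX (S := fun i => (i : M) ∈ X)
    (PDef.mem (X := X) (Y := X) (PTm.var ())) l
  exact ⟨p, hp⟩

end Expansion

theorem exists_forall_lt {M β : Type*} [LPA.Structure M] [ModelsPA M] [Finite β] (w : β → M) :
    ∃ m, ∀ i, w i < m := by
  obtain ⟨m, hm⟩ := Finite.exists_le w
  exact ⟨m + 1, fun i => lt_add_one_iff'.2 (hm i)⟩

/-! ### Extending inductive sets to cofinal extensions -/

section Extension

variable {M N : Type*} [LPA.Structure M] [LPA.Structure N]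

/-- The subset of `N` given by the codes `c m` of the initial parts of a subset of `M`. -/
def extSet (f : M ↪ₑ[LPA] N) (c : M → Fin 3 → M) : Set N :=
  {y | ∃ m, lt y (f m) ∧ entry (fun j => f (c m j)) y}

variable [ModelsPA M] [ModelsPA N] {f : M ↪ₑ[LPA] N} {c : M → Fin 3 → M} {X : Set M}

theorem map_lt_iff {a b : M} : f a < f b ↔ a < b :=
  ((PDef.lt' (ρ := ![a, b]) (ρ' := fun i => f (![a, b] i)) (β := Empty) (PTm.param 0)
    (PTm.param 1)).map_iff (f := f) Empty.elim).symm

theorem map_le_iff {a b : M} : f a ≤ f b ↔ a ≤ b := by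
  rw [← not_lt, ← not_lt, map_lt_iff]

/-- Two codes agree in `M` below both of their bounds. This is first-order in the codes, so their
images agree in `N`, and any `m` with `y < f m` decides membership of `y`. -/
theorem mem_extSet_iff (hc : ∀ m i, i < m → (entry (c m) i ↔ i ∈ X)) {m : M} {y : N}
    (hy : y < f m) : y ∈ extSet f c ↔ entry (fun j => f (c m j)) y := by
  have key : ∀ m', y < f m' →
      (entry (fun j => f (c m j)) y ↔ entry (fun j => f (c m' j)) y) := by
    intro m' hy'
    have h := PDef.forall_map_iff (L := LPA) (f := f) (ρ := id) (β := Unit)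
      (P := fun w => w () < m → w () < m' → (entry (fun j => c m j) (w ()) ↔
        entry (fun j => c m' j) (w ())))
      (P' := fun w => w () < f m → w () < f m' → (entry (fun j => f (c m j)) (w ()) ↔
        entry (fun j => f (c m' j)) (w ())))
      (PDef.imp (PDef.lt' (PTm.var _) (PTm.param m)) (PDef.imp (PDef.lt' (PTm.var _) (PTm.param m'))
        (PDef.iff (PDef.entry (fun j => PTm.param (c m j)) (PTm.var _))
          (PDef.entry (fun j => PTm.param (c m' j)) (PTm.var _)))))
    exact h.1 (fun w h1 h2 => (hc m _ h1).trans (hc m' _ h2).symm) (fun _ => y) hy hy'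
  constructor
  · rintro ⟨m', hy', he⟩
    exact (key m' hy').2 he
  · exact fun h => ⟨m, hy, h⟩

theorem sumElim_eta {K α β : Type*} (w : α ⊕ β → K) :
    Sum.elim (fun i => w (Sum.inl i)) (fun i => w (Sum.inr i)) = w :=
  Sum.elim_comp_inl_inr w

/-- Adding a value for a new bound variable to an assignment. -/
def snocVal {K α : Type*} {n : ℕ} (w : α ⊕ Fin n → K) (y : K) : α ⊕ Fin (n + 1) → K :=
  Sum.elim (fun i => w (Sum.inl i)) (Fin.snoc (fun i => w (Sum.inr i)) y)

theorem snocVal_lt {K α : Type*} [LT K] {n : ℕ} {w : α ⊕ Fin n → K} {y m : K}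
    (hw : ∀ i, w i < m) (hy : y < m) (i : α ⊕ Fin (n + 1)) : snocVal w y i < m := by
  rcases i with i | i
  · exact hw _
  · refine Fin.lastCases ?_ (fun i => ?_) i
    · simpa [snocVal] using hy
    · simpa [snocVal] using hw _

theorem PTm.snocVal {L : FirstOrder.Language.{0, 0}} {M N A : Type*} [L.Structure M]
    [L.Structure N] {ρ : A → M} {ρ' : A → N} {α β : Type*} {n : ℕ}
    {s : α ⊕ Fin n → (β → M) → M} {s' : α ⊕ Fin n → (β → N) → N} {t : (β → M) → M}
    {t' : (β → N) → N} (hs : ∀ i, PTm L ρ ρ' (s i) (s' i)) (ht : PTm L ρ ρ' t t')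
    (i : α ⊕ Fin (n + 1)) : PTm L ρ ρ' (fun w => snocVal (fun i => s i w) (t w) i)
      (fun w => PeanoArith.snocVal (fun i => s' i w) (t' w) i) := by
  rcases i with i | i
  · exact hs _
  · refine Fin.lastCases ?_ (fun i => ?_) i
    · simpa [PeanoArith.snocVal] using ht
    · simpa [PeanoArith.snocVal] using hs _

/-- For arguments below a bound `m`, a formula about `(M, X)` is equivalent to a formula about `M`
with parameters, and these parameters also work in the cofinal extension. -/
theorem exists_reflection (hcof : IsCofinalExt f) (hX : IsInductive X)
    (hc : ∀ m i, i < m → (entry (c m) i ↔ i ∈ X)) {α : Type*} [Finite α] {n : ℕ}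
    (φ : LPAX.BoundedFormula α n) : ∀ m : M,
      ∃ (P : (α ⊕ Fin n → M) → Prop) (P' : (α ⊕ Fin n → N) → Prop),
        PDef LPA (id : M → M) f P P' ∧
        (∀ w, (∀ i, w i < m) →
          (RealizeIn X φ (fun i => w (Sum.inl i)) (fun i => w (Sum.inr i)) ↔ P w)) ∧
        ∀ w, (∀ i, w i < f m) → (RealizeIn (extSet f c) φ (fun i => w (Sum.inl i))
          (fun i => w (Sum.inr i)) ↔ P' w) := by
  have hPA : M ⊨ PAStar (LHom.id LPA) := ModelsPA.models
  induction φ with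
  | falsum => exact fun m => ⟨fun _ => False, fun _ => False, PDef.const _, fun _ _ => Iff.rfl,
      fun _ _ => Iff.rfl⟩
  | equal t₁ t₂ =>
    intro m
    refine ⟨fun w => (toLPA t₁).realize w = (toLPA t₂).realize w,
      fun w => (toLPA t₁).realize w = (toLPA t₂).realize w, PDef.eq (PTm.term _) (PTm.term _),
      fun w _ => ?_, fun w _ => ?_⟩ <;>
    rw [realizeIn_equal, sumElim_eta]
  | @rel k l R ts =>
    intro m
    rcases R with R | R
    · refine ⟨fun w => Structure.RelMap (L := LPA) R fun i => (toLPA (ts i)).realize w,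
        fun w => Structure.RelMap (L := LPA) R fun i => (toLPA (ts i)).realize w,
        PDef.rel R fun i => PTm.term _, fun w _ => ?_, fun w _ => ?_⟩ <;>
      rw [realizeIn_rel, sumElim_eta]
    · obtain _ | _ := R
      -- Values of the term on arguments below `m` are bounded by some `u`, so the single code `c u`
      -- answers every query to the predicate.
      obtain ⟨u, hu⟩ := collection hPA m (P := fun w y => (toLPA (ts 0)).realize w = y)
        (PDef.eq ((PTm.term (toLPA (ts 0))).comp fun i => PTm.var (some i)) (PTm.var _))
      have hu' : ∀ w, (∀ i, w i < m) → (toLPA (ts 0)).realize w < u := fun w hw => by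
        obtain ⟨y, hy, rfl⟩ := hu w hw ⟨_, rfl⟩
        exact hy
      have hu'' : ∀ w, (∀ i, w i < f m) → (toLPA (ts 0)).realize w < f u :=
        (PDef.forall_map_iff (L := LPA) (f := f) (ρ := id) (PDef.imp
          (PDef.allFin fun i => PDef.lt' (PTm.var i) (PTm.param m))
          (PDef.lt' (PTm.term (toLPA (ts 0))) (PTm.param u)))).1 hu'
      refine ⟨fun w => entry (fun j => c u j) ((toLPA (ts 0)).realize w),
        fun w => entry (fun j => f (c u j)) ((toLPA (ts 0)).realize w),
        PDef.entry (fun j => PTm.param (c u j)) (PTm.term _), fun w hw => ?_, fun w hw => ?_⟩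
      · rw [realizeIn_pred, sumElim_eta]
        exact (hc u _ (hu' w hw)).symm
      · rw [realizeIn_pred, sumElim_eta]
        exact mem_extSet_iff hc (hu'' w hw)
  | imp φ ψ ihφ ihψ =>
    intro m
    obtain ⟨P, P', hP, h1, h2⟩ := ihφ m
    obtain ⟨Q, Q', hQ, k1, k2⟩ := ihψ m
    exact ⟨_, _, hP.imp hQ, fun w hw => imp_congr (h1 w hw) (k1 w hw),
      fun w hw => imp_congr (h2 w hw) (k2 w hw)⟩
  | @all n φ ih =>
    intro m
    -- Collection in `(M, X)`: for arguments below `m`, a universal statement that fails has a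
    -- counterexample below `u`. The bound `max u m` then accommodates both counterexamples and
    -- arguments.
    obtain ⟨u, hu⟩ := collection (K := Expansion X) hX m (β := α ⊕ Fin n) (P := fun w y =>
      ¬ RealizeIn X φ (fun i => snocVal w y (Sum.inl i)) (fun i => snocVal w y (Sum.inr i)))
      (PDef.not (DefP.realizeIn φ
        (s := fun i w => snocVal (fun i => w (some i)) (w none) (Sum.inl i))
        (u := fun i w => snocVal (fun i => w (some i)) (w none) (Sum.inr i))
        (fun i => PTm.snocVal (fun i => PTm.var _) (PTm.var _) _)
        (fun i => PTm.snocVal (fun i => PTm.var _) (PTm.var _) _)))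
    obtain ⟨P, P', hP, h1, h2⟩ := ih (max u m)
    have hbd : ∀ w : α ⊕ Fin n → M, (∀ i, w i < m) → ∀ m', max u m ≤ m' → ∀ y, y < m' →
        ∀ i, snocVal w y i < m' := fun w hw m' hm' y hy =>
      snocVal_lt (fun i => (hw i).trans_le ((le_max_right _ _).trans hm')) hy
    have hbd' : ∀ w : α ⊕ Fin n → N, (∀ i, w i < f m) → ∀ m', max u m ≤ m' → ∀ y, y < f m' →
        ∀ i, snocVal w y i < f m' := fun w hw m' hm' y hy =>
      snocVal_lt (fun i => (hw i).trans_le (map_le_iff.2 ((le_max_right _ _).trans hm'))) hy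
    have hM : ∀ w, (∀ i, w i < m) → (RealizeIn X φ.all (fun i => w (Sum.inl i))
        (fun i => w (Sum.inr i)) ↔ ∀ y, y < max u m → P (snocVal w y)) := fun w hw => by
      rw [realizeIn_all]
      constructor
      · exact fun h y hy => (h1 _ (hbd w hw _ le_rfl y hy)).1 (h y)
      · intro h
        by_contra! hne
        obtain ⟨y, hy, hny⟩ := hu w hw hne
        have hy' := lt_of_lt_of_le hy (le_max_left u m)
        exact hny ((h1 _ (hbd w hw _ le_rfl y hy')).2 (h y hy'))
    have hd : ∀ {Q : (α ⊕ Fin (n + 1) → M) → Prop} {Q' : (α ⊕ Fin (n + 1) → N) → Prop} (m' : M),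
        PDef LPA (id : M → M) f Q Q' → PDef LPA (id : M → M) f
          (fun w => ∀ y, y < m' → Q (snocVal w y)) (fun w => ∀ y, y < f m' → Q' (snocVal w y)) :=
      fun m' hQ => PDef.all (PDef.imp (PDef.lt' (PTm.var _) (PTm.param m'))
        (hQ.comp fun i => PTm.snocVal (fun i => PTm.var _) (PTm.var _) i))
    refine ⟨fun w => ∀ y, y < max u m → P (snocVal w y),
      fun w => ∀ y, y < f (max u m) → P' (snocVal w y), hd _ hP, hM, fun w hw => ?_⟩
    rw [realizeIn_all]
    constructor
    · exact fun h y hy => (h2 _ (hbd' w hw _ le_rfl y hy)).1 (h y)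
    · intro h y
      obtain ⟨a, ha⟩ := hcof y
      -- An arbitrary `y` of `N` may exceed `f (max u m)`, so the matrix is reflected again at a
      -- bound beyond `y`. That truth up to the first bound implies truth up to the second is
      -- arithmetical and holds in `M`, hence in `N`.
      obtain ⟨Q, Q', hQ, k1, k2⟩ := ih (max (max u m) a)
      have htr := (PDef.forall_map_iff (L := LPA) (f := f) (ρ := id) (PDef.imp
        (PDef.allFin fun i => PDef.lt' (PTm.var i) (PTm.param m))
        (PDef.imp (hd (max u m) hP) (hd (max (max u m) a) hQ)))).1 ?_ w hw h
      · have hy : y < f (max (max u m) a) := lt_of_lt_of_le ha (map_le_iff.2 (le_max_right _ _))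
        exact (k2 _ (hbd' w hw _ (le_max_left _ _) y hy)).2 (htr y hy)
      · exact fun w hw hP y hy =>
          (k1 _ (hbd w hw _ (le_max_left _ _) y hy)).1 ((hM w hw).2 hP y)

end Extension

/-! ### Properties of `X` inherited by the extended set -/

section Extension

variable {M N : Type*} [LPA.Structure M] [LPA.Structure N] {f : M ↪ₑ[LPA] N} {X : Set M}
  {Y : Set N}

theorem isDefinable_iff {X : Set M} : IsDefinable X ↔ DefP LPA fun w : Unit → M => w () ∈ X := by
  unfold IsDefinable Set.Definable₁
  rw [definable_univ_iff_DefP]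
  exact ⟨fun h => h.reindex fun _ => (), fun h => h.reindex fun _ => 0⟩

theorem IsElementaryExt.isInductive (h : IsElementaryExt f X Y) (hX : IsInductive X) :
    IsInductive Y := by
  obtain ⟨g, -⟩ := h
  exact (g.theory_model_iff _).1 hX

/-- For a fixed `φ`, the existence of parameters with which `φ` defines the predicate is one
sentence, so a definition of `Y` yields one of `X`. -/
theorem IsElementaryExt.not_isDefinable (h : IsElementaryExt f X Y) (hX : ¬ IsDefinable X) :
    ¬ IsDefinable Y := by
  obtain ⟨g, -⟩ := h
  intro hY
  obtain ⟨n, φ, p, hφ⟩ := (isDefinable_iff.1 hY).exists_formula_fin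
  have hdef : PDef LPAX (Empty.elim : Empty → Expansion X) (fun a => g (Empty.elim a))
      (fun _ : Empty → Expansion X => ∃ u : Fin n → Expansion X, ∀ x : Expansion X,
        (x : M) ∈ X ↔ φ.Realize (Sum.elim u fun _ => x))
      (fun _ : Empty → Expansion Y => ∃ u : Fin n → Expansion Y, ∀ x : Expansion Y,
        (x : N) ∈ Y ↔ φ.Realize (Sum.elim u fun _ => x)) := by
    refine PDef.existsTuple (PDef.all (PDef.iff (PDef.mem (PTm.var _)) (PDef.expand
      (PDef.formula φ (s := fun i w => Sum.elim (fun i => w (some (Sum.inr i)))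
        (fun _ => w none) i) (s' := fun i w => Sum.elim (fun i => w (some (Sum.inr i)))
        (fun _ => w none) i) ?_) LHom.sumInl)))
    rintro (i | i)
    · exact PTm.var _
    · exact PTm.var _
  obtain ⟨u, hu⟩ := (hdef.map_iff (f := g) Empty.elim).2 ⟨p, fun x => hφ fun _ => x⟩
  apply hX
  rw [isDefinable_iff]
  refine DefP.of_iff (PDef.formula φ (s := fun i w => Sum.elim u (fun _ => w ()) i)
    (s' := fun i w => Sum.elim u (fun _ => w ()) i) ?_) fun w => hu (w ())
  rintro (i | i)
  · exact PTm.elem (u i)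
  · exact PTm.var _

theorem PDef.extends {A β : Type*} {ρ : A → M} {ρ' : A → N} {p q : Fin 3 → (β → M) → M}
    {p' q' : Fin 3 → (β → N) → N} (hp : ∀ i, PTm LPA ρ ρ' (p i) (p' i))
    (hq : ∀ i, PTm LPA ρ ρ' (q i) (q' i)) :
    PDef LPA ρ ρ' (fun w => Extends (fun i => p i w) fun i => q i w)
      (fun w => Extends (fun i => p' i w) fun i => q' i w) := by
  have hsome : ∀ {r : Fin 3 → (β → M) → M} {r' : Fin 3 → (β → N) → N},
      (∀ i, PTm LPA ρ ρ' (r i) (r' i)) → ∀ i, PTm LPA ρ ρ'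
        (fun w : Option β → M => r i fun j => w (some j)) (fun w => r' i fun j => w (some j)) :=
    fun h i => (h i).comp fun j => PTm.var (some j)
  exact PDef.and (PDef.not (PDef.lt (hp 2) (hq 2))) (PDef.all (PDef.imp
    (PDef.lt (PTm.var none) (hsome hq 2)) (PDef.iff (PDef.entry (hsome hp) (PTm.var none))
      (PDef.entry (hsome hq) (PTm.var none)))))

/-- For a fixed `φ`, genericity for all dense sets that `φ` defines is one sentence, with the
parameters quantified. -/
theorem IsElementaryExt.isGeneric (h : IsElementaryExt f X Y) (hX : IsGeneric X) :
    IsGeneric Y := by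
  obtain ⟨g, -⟩ := h
  intro D hD hdense
  obtain ⟨n, φ, b, hφ⟩ := (definable_univ_iff_DefP.1 hD).exists_formula_fin
  have hdef : PDef LPAX (Empty.elim : Empty → Expansion X) (fun a => g (Empty.elim a))
      (fun _ : Empty → Expansion X => ∀ u : Fin n → Expansion X,
        (∀ q : Fin 3 → Expansion X, ∃ p : Fin 3 → Expansion X,
          φ.Realize (Sum.elim u p) ∧ Extends p q) →
        ∃ p : Fin 3 → Expansion X, φ.Realize (Sum.elim u p) ∧
          ∀ i, lt i (p 2) → (entry p i ↔ (i : M) ∈ X))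
      (fun _ : Empty → Expansion Y => ∀ u : Fin n → Expansion Y,
        (∀ q : Fin 3 → Expansion Y, ∃ p : Fin 3 → Expansion Y,
          φ.Realize (Sum.elim u p) ∧ Extends p q) →
        ∃ p : Fin 3 → Expansion Y, φ.Realize (Sum.elim u p) ∧
          ∀ i, lt i (p 2) → (entry p i ↔ (i : N) ∈ Y)) := by
    refine PDef.forallTuple (PDef.imp (PDef.expand (PDef.forallTuple (PDef.existsTuple
      (PDef.and ?_ (PDef.extends ?_ ?_)))) LHom.sumInl)
      (PDef.existsTuple (PDef.and (PDef.expand ?_ LHom.sumInl) (PDef.all (PDef.imp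
        (PDef.expand (PDef.lt ?_ ?_) LHom.sumInl) (PDef.iff
          (PDef.expand (PDef.entry ?_ ?_) LHom.sumInl) (PDef.mem (PTm.var _))))))))
    · refine PDef.formula φ (s := fun i w => Sum.elim (fun i => w (Sum.inl (Sum.inl (Sum.inr i))))
        (fun i => w (Sum.inr i)) i) (s' := fun i w => Sum.elim
        (fun i => w (Sum.inl (Sum.inl (Sum.inr i)))) (fun i => w (Sum.inr i)) i) ?_
      rintro (i | i)
      · exact PTm.var _
      · exact PTm.var _
    · exact fun i => PTm.var _
    · exact fun i => PTm.var _
    · refine PDef.formula φ (s := fun i w => Sum.elim (fun i => w (Sum.inl (Sum.inr i)))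
        (fun i => w (Sum.inr i)) i) (s' := fun i w => Sum.elim
        (fun i => w (Sum.inl (Sum.inr i))) (fun i => w (Sum.inr i)) i) ?_
      rintro (i | i)
      · exact PTm.var _
      · exact PTm.var _
    · exact PTm.var _
    · exact PTm.var _
    · exact fun i => PTm.var _
    · exact PTm.var _
  have hMX := (hdef.map_iff (f := g) Empty.elim).1 fun u hu => by
    refine hX {p | φ.Realize (Sum.elim u p)} (definable_univ_iff_DefP.2 ?_) hu
    refine PDef.formula φ (s := fun i w => Sum.elim u w i) (s' := fun i w => Sum.elim u w i) ?_
    rintro (i | i)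
    · exact PTm.elem (u i)
    · exact PTm.var _
  obtain ⟨p, hp, hpY⟩ := hMX b fun q => by
    obtain ⟨p, hp, hpq⟩ := hdense q
    exact ⟨p, (hφ p).1 hp, hpq⟩
  exact ⟨p, (hφ p).2 hp, hpY⟩

theorem definable_map {a : M} (h : (∅ : Set M).Definable₁ LPA {a}) (f : M ↪ₑ[LPA] N) :
    (∅ : Set N).Definable₁ LPA {f a} := by
  obtain ⟨φ, hφ⟩ := Set.empty_definable_iff.1 h
  refine Set.empty_definable_iff.2 ⟨φ, ?_⟩
  have hdef : PDef LPA (fun _ : Unit => a) (fun _ : Unit => f a)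
      (fun w : Fin 1 → M => w 0 = a ↔ φ.Realize w) (fun w => w 0 = f a ↔ φ.Realize w) :=
    PDef.iff (PDef.eq (PTm.var 0) (PTm.param ())) (PDef.formula φ fun i => PTm.var i)
  ext w
  exact hdef.forall_map_iff.1 (fun w => iff_of_eq (congrArg (w ∈ ·) hφ)) w

variable [ModelsPA M] [ModelsPA N] {c : M → Fin 3 → M}

/-- A given tuple lies below some `m`, where reflection reduces the formula on both sides to one
arithmetical formula, preserved by `f`. -/
theorem isElementaryExt_extSet (hcof : IsCofinalExt f) (hX : IsInductive X)
    (hc : ∀ m i, i < m → (entry (c m) i ↔ i ∈ X)) : IsElementaryExt f X (extSet f c) := by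
  refine ⟨⟨f, fun n φ x => ?_⟩, fun _ => rfl⟩
  obtain ⟨m, hm⟩ := exists_forall_lt (M := M) x
  obtain ⟨P, P', hP, h1, h2⟩ := exists_reflection hcof hX hc φ m
  have k1 := h1 (Sum.elim x default) (Sum.rec hm fun i => i.elim0)
  have k2 := h2 (fun i => f (Sum.elim x default i))
    (Sum.rec (fun i => map_lt_iff.2 (hm i)) fun i => i.elim0)
  have k := (k1.trans (PDef.map_iff (L := LPA) (f := f) (ρ := id) hP _)).trans k2.symm
  have e : (default : Fin 0 → N) = fun i => f (Sum.elim x default (Sum.inr i)) :=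
    Subsingleton.elim _ _
  refine Iff.trans (iff_of_eq ?_) k.symm
  exact congrArg (RealizeIn (extSet f c) φ fun i => f (x i)) e

/-- That `c m` codes `X` below `m` transfers to `f (c m)` and `Y`; by cofinality these codes exhaust
`Y`. -/
theorem IsElementaryExt.eq_extSet (hcof : IsCofinalExt f)
    (hc : ∀ m i, i < m → (entry (c m) i ↔ i ∈ X)) (h : IsElementaryExt f X Y) :
    Y = extSet f c := by
  obtain ⟨g, hg⟩ := h
  ext y
  obtain ⟨m, hm⟩ := hcof y
  rw [mem_extSet_iff hc hm]
  have hdef : PDef LPAX (id : Expansion X → Expansion X) (fun a => g (id a))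
      (fun w : Unit → Expansion X => w () < m → (entry (fun j => c m j) (w ()) ↔
        (w () : M) ∈ X))
      (fun w : Unit → Expansion Y => w () < g m → (entry (fun j => g (c m j)) (w ()) ↔
        (w () : N) ∈ Y)) :=
    PDef.imp (PDef.expand (PDef.lt' (M := Expansion X) (N := Expansion Y) (PTm.var _)
      (PTm.param (A := Expansion X) m)) LHom.sumInl)
      (PDef.iff (PDef.expand (PDef.entry (M := Expansion X) (N := Expansion Y)
        (fun j => PTm.param (A := Expansion X) (c m j)) (PTm.var _)) LHom.sumInl)
        (PDef.mem (PTm.var _)))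
  have := (hdef.forall_map_iff (f := g)).1 (fun w hw => hc m _ hw) (fun _ => y)
  simp only [hg] at this
  exact (this hm).symm

theorem isClass_extSet (hcof : IsCofinalExt f)
    (hc : ∀ m i, i < m → (entry (c m) i ↔ i ∈ X)) : IsClass (extSet f c) := by
  intro a
  obtain ⟨m, hm⟩ := hcof a
  rw [isDefinable_iff]
  refine DefP.of_iff (PDef.and (PDef.entry (fun j => PTm.elem (f (c m j))) (PTm.var ()))
    (PDef.lt (PTm.var ()) (PTm.elem a))) fun w => ?_
  constructor
  · exact fun h => ⟨(mem_extSet_iff hc (lt_trans h.2 hm)).1 h.1, h.2⟩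
  · exact fun h => ⟨(mem_extSet_iff hc (lt_trans h.2 hm)).2 h.1, h.2⟩

/-- Reflection at a bound above `a` and `b` removes the predicate from a definition of `b`, at the
price of parameters in the range of `f`; `hdcl` and `definable_map` remove these. -/
theorem isNeutral_extSet (hcof : IsCofinalExt f) (hX : IsInductive X)
    (hc : ∀ m i, i < m → (entry (c m) i ↔ i ∈ X))
    (hdcl : ∀ a : M, (∅ : Set M).Definable₁ LPA {a}) : IsNeutral (extSet f c) := by
  intro a b
  constructor
  · intro h
    exact Set.Definable.map_expansion (M := Expansion (extSet f c)) (L := LPA) (L' := LPAX) h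
      LHom.sumInl
  · intro h
    obtain ⟨φ, hφ⟩ := Set.definable_iff_exists_formula_sum.1 h
    obtain ⟨ma, hma⟩ := hcof a
    obtain ⟨mb, hmb⟩ := hcof b
    have hfin : Finite ({a} : Set (Expansion (extSet f c))) := (Set.finite_singleton _).to_subtype
    let m := max ma mb
    have ha : a < f m := lt_of_lt_of_le hma (map_le_iff.2 (le_max_left _ _))
    have hb : b < f m := lt_of_lt_of_le hmb (map_le_iff.2 (le_max_right _ _))
    obtain ⟨P, P', ⟨θ, -, hθ⟩, -, h2⟩ := exists_reflection hcof hX hc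
      (α := ({a} : Set (Expansion (extSet f c))) ⊕ Fin 1) φ m
    -- The reflected formula is reliable only below `f m`, so this bound has to be part of the
    -- definition of `b`.
    have key : ∀ y : N, y = b ↔ y < f m ∧
        θ.Realize (Sum.elim f (Sum.elim (Sum.elim (fun _ => a) fun _ => y) finZeroElim)) := by
      intro y
      have hy : y = b ↔ φ.Realize (M := Expansion (extSet f c))
          (Sum.elim (↑) fun _ : Fin 1 => y) :=
        iff_of_eq (congrArg ((fun _ : Fin 1 => y) ∈ ·) hφ)
      have hr : y < f m → (φ.Realize (M := Expansion (extSet f c))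
          (Sum.elim (↑) fun _ : Fin 1 => y) ↔ _) := fun hy => by
        refine Iff.trans ?_ ((h2 (Sum.elim (Sum.elim (fun _ => a) fun _ => y) finZeroElim) ?_).trans
          (hθ _))
        · unfold Formula.Realize RealizeIn
          apply iff_of_eq
          congr 1
          · funext i
            rcases i with ⟨i, hi⟩ | i
            · exact hi
            · rfl
        · rintro ((i | i) | i)
          · exact ha
          · exact hy
          · exact i.elim0
      constructor
      · intro h
        have hlt : y < f m := h ▸ hb
        exact ⟨hlt, (hr hlt).1 (hy.1 h)⟩
      · exact fun h => hy.2 ((hr h.1).2 h.2)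
    have hdef : (Set.range f ∪ {a}).Definable LPA {x : Fin 1 → N | x 0 = b} := by
      rw [definable_iff_PDef]
      have hfm : ∀ m, PTm LPA (β := Fin 1) (Subtype.val : ↥(Set.range f ∪ {a}) → N)
          (Subtype.val : ↥(Set.range f ∪ {a}) → N) (fun _ => f m) (fun _ => f m) := fun m =>
        PTm.param (A := ↥(Set.range f ∪ {a})) ⟨f m, Or.inl ⟨m, rfl⟩⟩
      refine PDef.of_iff (PDef.and (PDef.lt' (PTm.var 0) (hfm m)) (PDef.formula θ
        (s := fun i w => Sum.elim f (Sum.elim (Sum.elim (fun _ => a) fun _ => w 0) finZeroElim) i)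
        (s' := fun i w => Sum.elim f (Sum.elim (Sum.elim (fun _ => a) fun _ => w 0) finZeroElim) i)
        ?_)) (fun w => key (w 0)) (fun w => key (w 0))
      rintro (i | ((i | i) | i))
      · exact hfm i
      · exact PTm.param (A := ↥(Set.range f ∪ {a})) ⟨a, Or.inr rfl⟩
      · exact PTm.var 0
      · exact i.elim0
    refine definable_of_definable_params ?_ hdef
    rintro x (⟨m, rfl⟩ | rfl)
    · exact (definable_map (hdcl m) f).mono (Set.empty_subset _)
    · exact Set.Definable.singleton LPA x

end Extension

/-! ### Prime models -/

section Prime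

instance instCountableSymbols : Countable LPA.Symbols := by
  have h : Function.Injective fun s : LPA.Symbols => (match s with
    | Sum.inl ⟨_, ArithFunc.zero⟩ => 0
    | Sum.inl ⟨_, ArithFunc.one⟩ => 1
    | Sum.inl ⟨_, ArithFunc.add⟩ => 2
    | Sum.inl ⟨_, ArithFunc.mul⟩ => 3
    | Sum.inr ⟨_, ArithRel.lt⟩ => 4 : ℕ) := by
    rintro (⟨_, _ | _⟩ | ⟨_, _ | _⟩) (⟨_, _ | _⟩ | ⟨_, _ | _⟩) <;> simp
  exact h.countable

universe u

variable {M : Type u} [LPA.Structure M] [ModelsPA M]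

/-- The least element of a nonempty set defined from definable parameters is itself definable, which
is what the Tarski–Vaught test needs. -/
theorem meetsDefinable_definable : LPA.MeetsDefinable {a : M | (∅ : Set M).Definable₁ LPA {a}} := by
  rintro D ⟨d, hd⟩ hD
  have hD' := definable_iff_PDef.1 hD
  obtain ⟨b, hb, hmin⟩ := exists_least (K := M) (η := LHom.id LPA) ModelsPA.models (P := (· ∈ D))
    (hD'.left.reindex fun _ => ()) hd
  refine ⟨b, hb, definable_of_definable_params (fun a ha => ha) (definable_iff_PDef.2 ?_)⟩
  have hmem : ∀ {β : Type} (i : β), PDef LPA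
      (Subtype.val : {a : M | (∅ : Set M).Definable₁ LPA {a}} → M) Subtype.val
      (fun w : β → M => w i ∈ D) (fun w => w i ∈ D) := fun i => hD'.reindex fun _ => i
  refine PDef.of_iff (P := fun w => w 0 ∈ D ∧ ∀ c, c < w 0 → c ∉ D)
    (P' := fun w => w 0 ∈ D ∧ ∀ c, c < w 0 → c ∉ D)
    (PDef.and (hmem 0) (PDef.all (PDef.imp (PDef.lt' (PTm.var _) (PTm.var _))
      (PDef.not (hmem none))))) ?_ ?_ <;>
  · intro w
    constructor
    · intro h
      obtain rfl : w 0 = b := h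
      exact ⟨hb, hmin⟩
    · rintro ⟨h1, h2⟩
      refine le_antisymm (not_lt.1 fun h => h2 b h hb) (not_lt.1 fun h => hmin _ h h1)

/-- The elements of a prime model of Peano Arithmetic are definable. -/
theorem IsPrimeModel.definable_singleton (h : IsPrimeModel M) (a : M) :
    (∅ : Set M).Definable₁ LPA {a} := by
  let S := (meetsDefinable_definable (M := M)).toElementarySubstructure
  have hS : S ⊨ LPA.completeTheory M := (S.theory_model_iff _).2 inferInstance
  obtain ⟨g⟩ := h S
  have hmem : (∅ : Set M).Definable₁ LPA {(g a : M)} := by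
    have : (g a : M) ∈ (Substructure.closure LPA {a : M | (∅ : Set M).Definable₁ LPA {a}} :
      Set M) := (g a).2
    rw [(meetsDefinable_definable (M := M)).closure_eq_self] at this
    exact this
  obtain ⟨φ, hφ⟩ := Set.empty_definable_iff.1 hmem
  have h1 : φ.Realize fun _ : Fin 1 => (g a : M) :=
    (iff_of_eq (congrArg ((fun _ : Fin 1 => (g a : M)) ∈ ·) hφ)).1 rfl
  -- Both `g` and the inclusion of `S` are elementary, so `a` satisfies the formula whose only
  -- solution is `g a`.
  have h2 : φ.Realize fun _ : Fin 1 => a :=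
    (g.map_formula φ fun _ => a).1 ((S.subtype.map_formula φ fun _ => g a).1 h1)
  have h3 : a = g a := (iff_of_eq (congrArg ((fun _ : Fin 1 => a) ∈ ·) hφ)).2 h2
  rw [h3]
  exact hmem

/-- Distinct elements have distinct defining formulas, and there are countably many formulas. -/
theorem IsPrimeModel.countable (h : IsPrimeModel M) : Countable M := by
  choose φ hφ using fun a => Set.empty_definable_iff.1 (h.definable_singleton a)
  have : Function.Injective φ := fun a b hab => by
    have e : {x : Fin 1 → M | x 0 ∈ ({a} : Set M)} = {x : Fin 1 → M | x 0 ∈ ({b} : Set M)} := by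
      rw [hφ a, hφ b, hab]
    exact (iff_of_eq (congrArg ((fun _ : Fin 1 => a) ∈ ·) e)).1 rfl
  exact this.countable

end Prime

/-! ### Forcing -/

section Conditions

variable {M : Type*} [LPA.Structure M] [ModelsPA M] {p q r : Fin 3 → M} {X : Set M}

theorem extends_iff :
    Extends p q ↔ q 2 ≤ p 2 ∧ ∀ i, i < q 2 → (entry p i ↔ entry q i) :=
  and_congr (not_lt (a := p 2) (b := q 2)) Iff.rfl

theorem Extends.refl (p : Fin 3 → M) : Extends p p := extends_iff.2 ⟨le_rfl, fun _ _ => Iff.rfl⟩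

theorem Extends.trans (h : Extends p q) (k : Extends q r) : Extends p r := by
  rw [extends_iff] at *
  exact ⟨k.1.trans h.1, fun i hi => (h.2 i (hi.trans_le k.1)).trans (k.2 i hi)⟩

/-- The condition `p` codes an initial segment of the characteristic function of `X`. -/
def IsInitial (X : Set M) (p : Fin 3 → M) : Prop := ∀ i, i < p 2 → (entry p i ↔ i ∈ X)

theorem IsInitial.extends (hp : IsInitial X p) (hq : IsInitial X q) (h : q 2 ≤ p 2) :
    Extends p q :=
  extends_iff.2 ⟨h, fun i hi => (hp i (hi.trans_le h)).trans (hq i hi).symm⟩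

theorem IsInitial.exists_common (hp : IsInitial X p) (hq : IsInitial X q) :
    ∃ r, IsInitial X r ∧ Extends r p ∧ Extends r q := by
  rcases le_total (p 2) (q 2) with h | h
  · exact ⟨q, hq, hq.extends hp h, Extends.refl q⟩
  · exact ⟨p, hp, Extends.refl p, hp.extends hq h⟩

theorem IsGeneric.exists_initial (hX : IsGeneric X) {D : (Fin 3 → M) → Prop} (hD : DefP LPA D)
    (hdense : ∀ q, ∃ p, D p ∧ Extends p q) : ∃ p, D p ∧ IsInitial X p :=
  hX {p | D p} (definable_univ_iff_DefP.2 hD) hdense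

theorem IsGeneric.exists_initial_lt (hX : IsGeneric X) (t : M) :
    ∃ p, IsInitial X p ∧ t < p 2 := by
  obtain ⟨p, h1, h2⟩ := hX.exists_initial (D := fun p => t < p 2)
    (PDef.lt' (PTm.elem t) (PTm.var 2)) fun q => by
      -- Only the length grows; the new entries are whatever the same code happens to give.
      refine ⟨![q 0, q 1, max (q 2) (t + 1)], lt_of_lt_of_le (lt_add_one t) (le_max_right _ _),
        extends_iff.2 ⟨le_max_left _ _, fun i _ => entry_congr rfl rfl i⟩⟩
  exact ⟨p, h2, h1⟩

/-- Generic sets are undefinable. -/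
theorem IsGeneric.not_isDefinable (hX : IsGeneric X) : ¬ IsDefinable X := by
  rw [isDefinable_iff]
  intro hdef
  obtain ⟨p, ⟨i, hi, hne⟩, hp⟩ := hX.exists_initial
    (D := fun p => ∃ i, i < p 2 ∧ ¬ (entry (fun j => p j) i ↔ i ∈ X))
    (PDef.ex (PDef.and (PDef.lt' (PTm.var _) (PTm.var _)) (PDef.not (PDef.iff
      (PDef.entry (fun j => PTm.var _) (PTm.var _)) (hdef.reindex fun _ => none))))) fun q => by
      -- `q` is prolonged by one entry, at position `q 2`, chosen to disagree with `X`.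
      obtain ⟨p, hp2, hp⟩ := exists_code (η := LHom.id LPA) ModelsPA.models (S := fun i : M =>
        (i < q 2 ∧ entry (fun j => q j) i) ∨ (i = q 2 ∧ q 2 ∉ X))
        (PDef.or (PDef.and (PDef.lt' (PTm.var _) (PTm.elem _))
          (PDef.entry (fun j => PTm.elem _) (PTm.var _)))
          (PDef.and (PDef.eq (PTm.var _) (PTm.elem _)) (PDef.const _))) (q 2 + 1)
      refine ⟨p, ⟨q 2, hp2 ▸ lt_add_one _, fun h => ?_⟩, extends_iff.2 ⟨?_, fun i hi => ?_⟩⟩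
      · have := (hp (q 2) (lt_add_one _)).symm.trans h
        simp at this
      · rw [hp2]; exact (lt_add_one _).le
      · refine (hp i (hi.trans (lt_add_one _))).trans ⟨?_, fun h => Or.inl ⟨hi, h⟩⟩
        rintro (h | h)
        · exact h.2
        · exact absurd hi (h.1 ▸ lt_irrefl _)
  exact hne (hp i hi)

/-- Over a countable model there are generic sets. -/
theorem exists_isGeneric [Countable M] : ∃ X : Set M, IsGeneric X := by
  classical
  obtain ⟨e, he⟩ := exists_surjective_nat (LPA.Formula (M ⊕ Fin 3))
  let D : ℕ → (Fin 3 → M) → Prop := fun n p => (e n).Realize (Sum.elim id p)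
  -- All definable sets of conditions are treated, dense or not: each is entered whenever an
  -- extension in it exists.
  have hstep : ∀ n q, ∃ p, Extends p q ∧ ((∃ r, D n r ∧ Extends r q) → D n p) := fun n q => by
    by_cases h : ∃ r, D n r ∧ Extends r q
    · obtain ⟨r, hr, hrq⟩ := h
      exact ⟨r, hrq, fun _ => hr⟩
    · exact ⟨q, Extends.refl q, fun h' => absurd h' h⟩
  choose next hnext hD using hstep
  let s : ℕ → Fin 3 → M := fun n => Nat.rec (fun _ => 0) (fun n q => next n q) n
  have hs : ∀ {m n}, m ≤ n → Extends (s n) (s m) := fun {m n} h => by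
    induction h with
    | refl => exact Extends.refl _
    | step _ ih => exact (hnext _ _).trans ih
  refine ⟨{i | ∃ n, i < s n 2 ∧ entry (s n) i}, fun E hE hdense => ?_⟩
  obtain ⟨θ, hθ, -⟩ := definable_univ_iff_DefP.1 hE
  obtain ⟨n, rfl⟩ := he θ
  refine ⟨s (n + 1), (hθ _).2 (hD n (s n) ?_), fun i hi => ⟨fun h => ⟨n + 1, hi, h⟩, ?_⟩⟩
  · obtain ⟨r, hr, hrs⟩ := hdense (s n)
    exact ⟨r, (hθ r).1 hr, hrs⟩
  · rintro ⟨m, hm, h⟩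
    rcases le_total m (n + 1) with hmn | hmn
    · exact ((extends_iff.1 (hs hmn)).2 i hm).2 h
    · exact ((extends_iff.1 (hs hmn)).2 i hi).1 h

end Conditions

/-! ### The forcing relation and truth in generic expansions -/

section Forcing

variable {M : Type*} [LPA.Structure M]

/-- Forcing for atomic relations. -/
def forcesRel (p : Fin 3 → M) : ∀ {l : ℕ}, LPAX.Relations l → (Fin l → M) → Prop
  | _, Sum.inl R, x => Structure.RelMap (L := LPA) R x
  | _, Sum.inr PredRel.pred, x => ∀ q, Extends q p → lt (x 0) (q 2) → entry q (x 0)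

/-- The forcing relation. -/
def Forces {α : Type*} : ∀ {n : ℕ}, LPAX.BoundedFormula α n → (Fin 3 → M) →
    (α ⊕ Fin n → M) → Prop
  | _, BoundedFormula.falsum, _, _ => False
  | _, BoundedFormula.equal t s, _, w => (toLPA t).realize w = (toLPA s).realize w
  | _, BoundedFormula.rel R ts, p, w => forcesRel p R fun i => (toLPA (ts i)).realize w
  | _, BoundedFormula.imp φ ψ, p, w => ∀ q, Extends q p → Forces φ q w → Forces ψ q w
  | _, BoundedFormula.all φ, p, w => ∀ a, Forces φ p (snocVal w a)

variable {α : Type*}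

/-- Each clause only quantifies over conditions or elements, so recursion on the formula applies.
This allows a generic set to meet dense sets described through forcing. -/
theorem DefP.forces {n : ℕ} (φ : LPAX.BoundedFormula α n) {β : Type*} {p : Fin 3 → (β → M) → M}
    {s : α ⊕ Fin n → (β → M) → M} (hp : ∀ i, PTm LPA (id : M → M) (id : M → M) (p i) (p i))
    (hs : ∀ i, PTm LPA (id : M → M) (id : M → M) (s i) (s i)) :
    DefP LPA fun w => Forces φ (fun i => p i w) fun i => s i w := by
  have weaken : ∀ {γ : Type} {β : Type _} {t : (β → M) → M},
      PTm LPA (id : M → M) (id : M → M) t t → PTm LPA (id : M → M) (id : M → M)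
      (fun w : β ⊕ γ → M => t fun i => w (Sum.inl i)) (fun w => t fun i => w (Sum.inl i)) :=
    fun h => h.comp fun i => PTm.var _
  induction φ generalizing β with
  | falsum => exact PDef.const False
  | equal t₁ t₂ => exact PDef.eq ((PTm.term _).comp hs) ((PTm.term _).comp hs)
  | @rel k l R ts =>
    rcases R with R | R
    · exact PDef.rel R fun i => (PTm.term _).comp hs
    · obtain _ | _ := R
      have ht : PTm LPA (id : M → M) (id : M → M) (fun w => (toLPA (ts 0)).realize fun i => s i w)
        (fun w => (toLPA (ts 0)).realize fun i => s i w) := (PTm.term _).comp hs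
      exact PDef.forallTuple (PDef.imp (PDef.extends (fun i => PTm.var _) fun i => weaken (hp i))
        (PDef.imp (PDef.lt (weaken ht) (PTm.var _)) (PDef.entry (fun i => PTm.var _) (weaken ht))))
  | imp φ ψ ihφ ihψ =>
    exact PDef.forallTuple (PDef.imp (PDef.extends (fun i => PTm.var _) fun i => weaken (hp i))
      (PDef.imp (ihφ (fun i => PTm.var _) fun i => weaken (hs i))
        (ihψ (fun i => PTm.var _) fun i => weaken (hs i))))
  | all φ ih =>
    exact PDef.all (ih (fun i => (hp i).comp fun i => PTm.var _)
      (PTm.snocVal (fun i => (hs i).comp fun i => PTm.var _) (PTm.var _)))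

variable [ModelsPA M]

theorem Forces.mono {n : ℕ} {φ : LPAX.BoundedFormula α n} {p q : Fin 3 → M} {w : α ⊕ Fin n → M}
    (h : Forces φ p w) (hqp : Extends q p) : Forces φ q w := by
  induction φ with
  | falsum => exact h
  | equal t₁ t₂ => exact h
  | rel R ts =>
    rcases R with R | R
    · exact h
    · obtain _ | _ := R
      exact fun r hr => h r (hr.trans hqp)
  | imp φ ψ _ _ => exact fun r hr => h r (hr.trans hqp)
  | all φ ih => exact fun a => ih (h a)

/-- The primitives are only falsity, implication and universal quantification, and the clause for
the predicate refers just to extensions long enough to decide it. Hence forcing on a dense set below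
`p` is already forcing by `p`. -/
theorem forces_of_dense {n : ℕ} {φ : LPAX.BoundedFormula α n} {p : Fin 3 → M} {w : α ⊕ Fin n → M}
    (h : ∀ q, Extends q p → ∃ r, Extends r q ∧ Forces φ r w) : Forces φ p w := by
  induction φ generalizing p with
  | falsum =>
    obtain ⟨r, -, hr⟩ := h p (Extends.refl p)
    exact hr
  | equal t₁ t₂ =>
    obtain ⟨r, -, hr⟩ := h p (Extends.refl p)
    exact hr
  | rel R ts =>
    rcases R with R | R
    · obtain ⟨r, -, hr⟩ := h p (Extends.refl p)
      exact hr
    · obtain _ | _ := R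
      intro q hq hlt
      obtain ⟨r, hrq, hr⟩ := h q hq
      have hrq' := extends_iff.1 hrq
      exact (hrq'.2 _ hlt).1 (hr r (Extends.refl r) (lt_of_lt_of_le hlt hrq'.1))
  | imp φ ψ _ ihψ =>
    intro q hq hφ
    refine ihψ fun q' hq' => ?_
    obtain ⟨r, hr, hφψ⟩ := h q' (hq'.trans hq)
    exact ⟨r, hr, hφψ r (Extends.refl r) (hφ.mono (hr.trans hq'))⟩
  | all φ ih =>
    intro a
    refine ih fun q hq => ?_
    obtain ⟨r, hr, hφ⟩ := h q hq
    exact ⟨r, hr, hφ a⟩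

theorem exists_extends_not_forces {n : ℕ} {φ : LPAX.BoundedFormula α n} {p : Fin 3 → M}
    {w : α ⊕ Fin n → M} (h : ¬ Forces φ p w) :
    ∃ q, Extends q p ∧ ∀ r, Extends r q → ¬ Forces φ r w := by
  by_contra! hne
  exact h (forces_of_dense hne)

/-- Truth in a generic expansion is forced by initial segments. -/
theorem IsGeneric.realizeIn_iff {X : Set M} (hX : IsGeneric X) {n : ℕ}
    (φ : LPAX.BoundedFormula α n) (w : α ⊕ Fin n → M) :
    RealizeIn X φ (fun i => w (Sum.inl i)) (fun i => w (Sum.inr i)) ↔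
      ∃ p, IsInitial X p ∧ Forces φ p w := by
  obtain ⟨p₀, hp₀, -⟩ := hX.exists_initial_lt 0
  induction φ with
  | falsum => exact ⟨fun h => h.elim, fun ⟨_, _, h⟩ => h.elim⟩
  | equal t₁ t₂ =>
    rw [realizeIn_equal, sumElim_eta]
    exact ⟨fun h => ⟨p₀, hp₀, h⟩, fun ⟨_, _, h⟩ => h⟩
  | rel R ts =>
    rcases R with R | R
    · rw [realizeIn_rel, sumElim_eta]
      exact ⟨fun h => ⟨p₀, hp₀, h⟩, fun ⟨_, _, h⟩ => h⟩
    · obtain _ | _ := R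
      rw [realizeIn_pred, sumElim_eta]
      obtain ⟨q, hq, hlt⟩ := hX.exists_initial_lt ((toLPA (ts 0)).realize w)
      constructor
      · intro h
        refine ⟨q, hq, fun r hr _ => ?_⟩
        exact ((extends_iff.1 hr).2 _ hlt).2 ((hq _ hlt).2 h)
      · rintro ⟨p, hp, h⟩
        obtain ⟨r, hr, hrp, hrq⟩ := hp.exists_common hq
        have hlt' := lt_of_lt_of_le hlt (extends_iff.1 hrq).1
        exact (hr _ hlt').1 (h r hrp hlt')
  | imp φ ψ ihφ ihψ =>
    rw [realizeIn_imp, ihφ, ihψ]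
    constructor
    · intro h
      -- Dense alternative: a condition forces the implication, or it forces `φ` while no extension
      -- forces `ψ`. An initial segment of the second kind contradicts truth of the implication.
      obtain ⟨p, hp, hinit⟩ := hX.exists_initial (D := fun p =>
        Forces (φ.imp ψ) (fun i => p i) w ∨
          Forces φ (fun i => p i) w ∧ ∀ r : Fin 3 → M, Extends r p → ¬ Forces ψ r w)
        (PDef.or (DefP.forces _ (fun i => PTm.var _) fun i => PTm.elem (w i))
          (PDef.and (DefP.forces _ (fun i => PTm.var _) fun i => PTm.elem (w i))
            (PDef.forallTuple (PDef.imp (PDef.extends (fun i => PTm.var _) fun i => PTm.var _)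
              (PDef.not (DefP.forces _ (fun i => PTm.var _) fun i => PTm.elem (w i)))))))
        fun q => by
          by_cases hq : Forces (φ.imp ψ) q w
          · exact ⟨q, Or.inl hq, Extends.refl q⟩
          · have : ∃ r, Extends r q ∧ Forces φ r w ∧ ¬ Forces ψ r w := by
              by_contra! hne
              exact hq hne
            obtain ⟨r, hr, hφ, hψ⟩ := this
            obtain ⟨r', hr', hψ'⟩ := exists_extends_not_forces hψ
            exact ⟨r', Or.inr ⟨hφ.mono hr', hψ'⟩, hr'.trans hr⟩
      rcases hp with hp | ⟨hφ, hψ⟩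
      · exact ⟨p, hinit, hp⟩
      · obtain ⟨q, hq, hqψ⟩ := h ⟨p, hinit, hφ⟩
        obtain ⟨r, hr, hrp, hrq⟩ := hinit.exists_common hq
        exact absurd (hqψ.mono hrq) (hψ r hrp)
    · rintro ⟨p, hp, h⟩ ⟨q, hq, hφ⟩
      obtain ⟨r, hr, hrp, hrq⟩ := hp.exists_common hq
      exact ⟨r, hr, h r hrp (hφ.mono hrq)⟩
  | all φ ih =>
    rw [realizeIn_all]
    have ih' := fun a => ih (snocVal w a)
    constructor
    · intro h
      -- Dense alternative: a condition forces the universal statement, or some instance `a` is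
      -- forced by none of its extensions.
      obtain ⟨p, hp, hinit⟩ := hX.exists_initial (D := fun p =>
        Forces φ.all (fun i => p i) w ∨
          ∃ a, ∀ r : Fin 3 → M, Extends r p → ¬ Forces φ r (snocVal w a))
        (PDef.or (DefP.forces _ (fun i => PTm.var _) fun i => PTm.elem (w i))
          (PDef.ex (PDef.forallTuple (PDef.imp
            (PDef.extends (fun i => PTm.var _) fun i => PTm.var _)
            (PDef.not (DefP.forces _ (fun i => PTm.var _)
              (PTm.snocVal (fun i => PTm.elem (w i)) (PTm.var _))))))))
        fun q => by
          by_cases hq : Forces φ.all q w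
          · exact ⟨q, Or.inl hq, Extends.refl q⟩
          · obtain ⟨a, ha⟩ := not_forall.1 hq
            obtain ⟨r, hr, hφ⟩ := exists_extends_not_forces ha
            exact ⟨r, Or.inr ⟨a, hφ⟩, hr⟩
      rcases hp with hp | ⟨a, ha⟩
      · exact ⟨p, hinit, hp⟩
      · obtain ⟨q, hq, hqφ⟩ := (ih' a).1 (h a)
        obtain ⟨r, hr, hrp, hrq⟩ := hinit.exists_common hq
        exact absurd (hqφ.mono hrq) (ha r hrp)
    · rintro ⟨p, hp, h⟩ a
      exact (ih' a).2 ⟨p, hp, h a⟩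

/-- Generic sets are inductive. -/
theorem IsGeneric.isInductive {X : Set M} (hX : IsGeneric X) : IsInductive X := by
  unfold IsInductive
  rw [models_PAStar_iff]
  refine ⟨(models_PAStar_iff.1 (ModelsPA.models (M := M))).1, fun P hP h0 hs => ?_⟩
  obtain ⟨n, φ, b, hφ⟩ := hP.exists_formula_fin
  let asg : M → (Fin n ⊕ Unit) ⊕ Fin 0 → M := fun x =>
    Sum.elim (Sum.elim b fun _ => x) Fin.elim0
  have hasg : ∀ {β : Type} {t : (β → M) → M}, PTm LPA (id : M → M) (id : M → M) t t →
      ∀ i, PTm LPA (id : M → M) (id : M → M) (fun w => asg (t w) i) (fun w => asg (t w) i) := by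
    rintro β t ht ((i | i) | i)
    · exact PTm.elem (b i)
    · exact ht
    · exact i.elim0
  have htruth : ∀ x, ¬ P x ↔ ∃ p, IsInitial X p ∧ Forces φ.not p (asg x) := fun x => by
    refine Iff.trans ?_ (hX.realizeIn_iff φ.not (asg x))
    refine not_congr ((hφ fun _ => x).trans (iff_of_eq ?_))
    exact congrArg (RealizeIn X φ _) (Subsingleton.elim _ _)
  -- Dense alternative: `q` excludes every counterexample to `P`, or it forces one at `y` and
  -- excludes all smaller ones. Density comes from the least `y` at which an extension can force a
  -- counterexample.
  obtain ⟨q, hq, hinit⟩ := hX.exists_initial (D := fun q =>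
      (∀ x, ∀ r : Fin 3 → M, Extends r q → ¬ Forces φ.not r (asg x)) ∨
      ∃ y, Forces φ.not (fun i => q i) (asg y) ∧
        ∀ x, x < y → ∀ r : Fin 3 → M, Extends r q → ¬ Forces φ.not r (asg x))
    (PDef.or (PDef.all (PDef.forallTuple (PDef.imp
        (PDef.extends (fun i => PTm.var _) fun i => PTm.var _)
        (PDef.not (DefP.forces _ (fun i => PTm.var _) (hasg (PTm.var _)))))))
      (PDef.ex (PDef.and (DefP.forces _ (fun i => PTm.var _) (hasg (PTm.var _)))
        (PDef.all (PDef.imp (PDef.lt' (PTm.var _) (PTm.var _)) (PDef.forallTuple (PDef.imp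
          (PDef.extends (fun i => PTm.var _) fun i => PTm.var _)
          (PDef.not (DefP.forces _ (fun i => PTm.var _) (hasg (PTm.var _)))))))))))
    fun q => by
      by_cases h : ∃ x, ∃ r : Fin 3 → M, Extends r q ∧ Forces φ.not r (asg x)
      · obtain ⟨x, hx⟩ := h
        obtain ⟨y, ⟨r, hr, hy⟩, hmin⟩ := exists_least (K := M) (η := LHom.id LPA) ModelsPA.models
          (P := fun x => ∃ r : Fin 3 → M, Extends r q ∧ Forces φ.not r (asg x))
          (PDef.existsTuple (PDef.and (PDef.extends (fun i => PTm.var _) fun i => PTm.elem (q i))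
            (DefP.forces _ (fun i => PTm.var _) (hasg (PTm.var _))))) hx
        exact ⟨r, Or.inr ⟨y, hy, fun x hxy r' hr' hf => hmin x hxy ⟨r', hr'.trans hr, hf⟩⟩, hr⟩
      · push Not at h
        exact ⟨q, Or.inl h, Extends.refl q⟩
  have hcompat : ∀ x, (∀ r : Fin 3 → M, Extends r q → ¬ Forces φ.not r (asg x)) → P x :=
    fun x hx => by
      by_contra hPx
      obtain ⟨p, hp, hf⟩ := (htruth x).1 hPx
      obtain ⟨r, hr, hrq, hrp⟩ := hinit.exists_common hp
      exact hx r hrq (hf.mono hrp)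
  rcases hq with hq | ⟨y, hy, hmin⟩
  · exact fun x => hcompat x (hq x)
  · exfalso
    refine (htruth y).2 ⟨q, hinit, hy⟩ ?_
    -- `P` holds at the predecessor of `y` since counterexamples below `y` are excluded, so `P y`
    -- follows after all.
    rcases eq_zero_or_succ y with rfl | ⟨z, rfl⟩
    · exact h0
    · exact hs z (hcompat z (hmin z (lt_add_one z)))

end Forcing

end PeanoArith

/-! ### Proof of the proposition -/

theorem mainTheorem3 {M N : Type*} [PeanoArith.LPA.Structure M] [PeanoArith.LPA.Structure N]
    (hPA : M ⊨ PeanoArith.PA) (hprime : PeanoArith.IsPrimeModel M)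
    (f : M ↪ₑ[PeanoArith.LPA] N) (hcof : PeanoArith.IsCofinalExt f) :
    PeanoArith.NeutrallyExpandable N ∧
    (∃ X : Set M, PeanoArith.IsGeneric X ∧ ¬ PeanoArith.IsDefinable X ∧ PeanoArith.IsInductive X) ∧
    ∀ X : Set M, ¬ PeanoArith.IsDefinable X → PeanoArith.IsInductive X →
      ∃ Y : Set N, PeanoArith.IsElementaryExt f X Y ∧
        (∀ Y' : Set N, PeanoArith.IsElementaryExt f X Y' → Y' = Y) ∧
        ¬ PeanoArith.IsDefinable Y ∧ PeanoArith.IsInductive Y ∧ PeanoArith.IsClass Y ∧ PeanoArith.IsNeutral Y ∧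
        (PeanoArith.IsGeneric X → PeanoArith.IsGeneric Y) := by
  have hM : PeanoArith.ModelsPA M := ⟨hPA⟩
  have hN : PeanoArith.ModelsPA N := ⟨(f.theory_model_iff _).1 hPA⟩
  have hext : ∀ X : Set M, ¬ PeanoArith.IsDefinable X → PeanoArith.IsInductive X →
      ∃ Y : Set N, PeanoArith.IsElementaryExt f X Y ∧
        (∀ Y' : Set N, PeanoArith.IsElementaryExt f X Y' → Y' = Y) ∧
        ¬ PeanoArith.IsDefinable Y ∧ PeanoArith.IsInductive Y ∧ PeanoArith.IsClass Y ∧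
        PeanoArith.IsNeutral Y ∧ (PeanoArith.IsGeneric X → PeanoArith.IsGeneric Y) := by
    intro X hdef hX
    choose c hc using hX.exists_initial_code
    have hY := PeanoArith.isElementaryExt_extSet hcof hX hc
    exact ⟨PeanoArith.extSet f c, hY, fun Y' h => h.eq_extSet hcof hc, hY.not_isDefinable hdef,
      hY.isInductive hX, PeanoArith.isClass_extSet hcof hc,
      PeanoArith.isNeutral_extSet hcof hX hc hprime.definable_singleton, hY.isGeneric⟩
  have := hprime.countable
  obtain ⟨X, hX⟩ := PeanoArith.exists_isGeneric (M := M)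
  obtain ⟨Y, -, -, h1, -, h2, h3, -⟩ := hext X hX.not_isDefinable hX.isInductive
  exact ⟨⟨Y, h1, h3, h2⟩, ⟨X, hX, hX.not_isDefinable, hX.isInductive⟩, hext⟩
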